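/- **Setting.** Let $p>0$, $\alpha:=2/(1+p)$, $c(\theta):=\cos\theta|\cos\theta|^p$, $s(\theta):=\sin\theta|\sin\theta|^p$. Let $\mu_0$ be a probability measure on $\mathbb R$ with distribution function $F_0$ and characteristic function $\phi_0$, and let $\mu(\cdot,t)$, $t\ge 0$, be probability measures on $\mathbb{R}$, with distribution functions $F(\cdot,t)$, whose characteristic functions $\phi(\cdot,t)$ solve the inelastic Kac equation $$\frac{\partial}{\partial t}\phi(\xi,t)=\frac1{2\pi}\int_0^{2\pi}\phi(\xi s(\theta),t)\,\phi(\xi c(\theta),t)\,d\theta-\phi(\xi,t)\quad(t>0),\qquad \mu(\cdot,0)=\mu_0,$$ $t\mapsto\phi(\xi,t)$ being continuous on $[0,\infty)$ for every $\xi\in\mathbb R$. Let $a_0>0$ and let $G_\alpha$ be the stable law with characteristic function $\exp(-a_0|\xi|^\alpha)$. For $s>0$ put $$\chi_s(F(\cdot,t),G_\alpha):=\sup_{\xi\ne0}\frac{|\phi(\xi,t)-e^{-a_0|\xi|^\alpha}|}{|\xi|^s},\qquad A_m:=\frac1{2\pi}\int_0^{2\pi}|\sin\theta|^m\,d\theta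 .$$ Assume that $F_0$ belongs to the domain of normal attraction of $G_\alpha$, i.e. for i.i.d. $X_1,X_2,\dots$ with law $\mu_0$ and suitable constants $m_n$, $n^{-1/\alpha}\sum_{i\le n}X_i-m_n$ converges in law to $G_\alpha$. Define $v_0$ and $v_0^*$ by $v_0(0)=v_0^*(0)=0$ and, for $\xi\neq 0$, $$1-\phi_0(\xi)=(a_0+v_0(\xi))|\xi|^\alpha,\qquad 1-\mathrm{Re}\,\phi_0(\xi)=(a_0+v_0^*(\xi))|\xi|^\alpha ,$$ and assume that, for some $\delta>0$, $|v_0(\xi)|=O(|\xi|^\delta)$ as $\xi\to0$. Put $$M:=a_0+\sup_{\xi\ge0}|v_0^*(\xi)|,\quad \bar v_0^*(\xi):=\sup_{0\le x\le\xi}|v_0^*(x)|,\quad d_1:=\Big(\frac{3}{8M}\Big)^{1/\alpha},\quad M_r:=\max_{x\ge0}x^{r\alpha}e^{-(a_0-\eta)x^\alpha}.$$ **Theorem.** For every $\eta\in(0,a_0)$ there are $d\in(0,1)$ and $\rho>0$ such that (i) $\frac45M^2|x|^\alpha+\bar v_0^*(|x|)\le\eta$ whenever $|x|\le(3d/(8M))^{1/\alpha}$;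 (ii) $|v_0(x)|\le\rho|x|^\delta$ whenever $|x|\le d_1d^{1/\alpha}$. For any $\eta\in(0,a_0)$, $d\in(0,1)$, $\rho>0$ satisfying (i) and (ii), and all $t\ge0$: if $\delta\in(0,\alpha]$, then $$\begin{aligned}\chi_{\alpha+\delta}(F(\cdot,t),G_\alpha)\le{}&\Big(\rho+\frac{2}{d_1^{\alpha+\delta}d^{(\alpha+\delta)/\alpha}}\Big)e^{-t(1-2A_{2(1+\delta/\alpha)})}+\frac45M^2M_{\frac{\alpha-\delta}{\alpha}}e^{-t(1-2A_4)}\\&+2\rho^2M_{\frac{\alpha+\delta}{\alpha}}e^{-t(1-2A_{2(1+2\delta/\alpha)})}+\frac{32}{25}M^4M_{\frac{3\alpha-\delta}{\alpha}}e^{-t(1-2A_6)}+e^{-t}\sup_{\xi\ne0}\frac{|\mathrm{Im}\,v_0(\xi)|}{|\xi|^\delta};\end{aligned}$$ if $\delta\in(\alpha,2\alpha]$, then $$\begin{aligned}\chi_{2\alpha}(F(\cdot,t),G_\alpha)\le{}&\Big(\frac45M^2+\frac{2}{d_1^{2\alpha}d^2}\Big)e^{-t(1-2A_4)}+\rho M_{\frac{\delta-\alpha}{\alpha}}e^{-t(1-2A_{2(1+\delta/\alpha)})}\\&+\frac{32}{25}M^4M_2e^{-t(1-2A_6)}+2\rho^2M_{\frac{2\delta}{\alpha}}e^{-t(1-2A_{2(1+2\delta/\alpha)})}+e^{-t}\sup_{\xi\ne0}\frac{|\mathrm{Im}\,v_0(\xi)|}{|\xi|^\alpha}.\end{aligned}$$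 In particular there are constants $a_1$, $a_2$, independent of $t\ge0$, such that $\chi_{\alpha+\delta}(F(\cdot,t),G_\alpha)\le a_1e^{-t(1-2A_{2(1+\delta/\alpha)})}$ for all $t\ge 0$ if $\delta\in(0,\alpha]$, and $\chi_{2\alpha}(F(\cdot,t),G_\alpha)\le a_2e^{-t(1-2A_4)}$ for all $t\ge 0$ if $\delta\in(\alpha,2\alpha]$. -/

import Mathlib

open MeasureTheory ProbabilityTheory Filter Topology Set

namespace InelasticKac

noncomputable section

/-- The post-collisional coefficient `c(θ) = cos θ |cos θ|^p`. -/
def cCoef (p θ : ℝ) : ℝ := Real.cos θ * |Real.cos θ| ^ p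

/-- The post-collisional coefficient `s(θ) = sin θ |sin θ|^p`. -/
def sCoef (p θ : ℝ) : ℝ := Real.sin θ * |Real.sin θ| ^ p

/-- `μ t`, `t ≥ 0`, is a solution with initial datum `μ₀` of the Fourier-transformed inelastic
Kac equation: for each `ξ` the characteristic function `φ(ξ, t)` of `μ t` is continuous on
`[0, ∞)` and, for `t > 0`,
`∂φ/∂t (ξ,t) = (1/2π) ∫₀^{2π} φ(ξ s(θ), t) φ(ξ c(θ), t) dθ - φ(ξ,t)`.
Values of `μ` at negative times play no role. -/
structure IsKacSolution (p : ℝ) (μ₀ : ProbabilityMeasure ℝ) (μ : ℝ → ProbabilityMeasure ℝ) :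
    Prop where
  initial : μ 0 = μ₀
  continuousOn : ∀ ξ : ℝ, ContinuousOn (fun t => charFun (μ t : Measure ℝ) ξ) (Ici 0)
  hasDerivAt : ∀ ξ t : ℝ, 0 < t →
    HasDerivAt (fun t => charFun (μ t : Measure ℝ) ξ)
      ((1 / (2 * (Real.pi : ℂ))) * (∫ θ in (0 : ℝ)..(2 * Real.pi),
          charFun (μ t : Measure ℝ) (ξ * sCoef p θ) * charFun (μ t : Measure ℝ) (ξ * cCoef p θ))
        - charFun (μ t : Measure ℝ) ξ) t

/-- `G` is the symmetric stable law with characteristic function `exp (-a₀ |ξ|^α)`. -/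
def IsStableLaw (α a₀ : ℝ) (G : ProbabilityMeasure ℝ) : Prop :=
  ∀ ξ : ℝ, charFun (G : Measure ℝ) ξ = ((Real.exp (-a₀ * |ξ| ^ α) : ℝ) : ℂ)

/-- `μ₀` belongs to the domain of normal attraction of `G` (with exponent `α`): if
`X₁, X₂, …` are i.i.d. with law `μ₀`, then `(X₁ + ⋯ + Xₙ) / n^{1/α} - mₙ` converges in law to `G`
for suitable constants `mₙ`. The `Xᵢ` are the coordinates on `ℝ^ℕ` under the product measure. -/
def InNormalDomain (α : ℝ) (G μ₀ : ProbabilityMeasure ℝ) : Prop :=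
  ∃ m : ℕ → ℝ, TendstoInDistribution
    (fun (n : ℕ) (x : ℕ → ℝ) => (∑ i ∈ Finset.range n, x i) / (n : ℝ) ^ (1 / α) - m n)
    atTop (id : ℝ → ℝ)
    (fun _ => Measure.infinitePi (fun _ : ℕ => (μ₀ : Measure ℝ))) (G : Measure ℝ)

/-- The function `v₀` with `1 - φ₀(ξ) = (a₀ + v₀(ξ)) |ξ|^α`, normalized by `v₀(0) = 0`. -/
def v0 (α a₀ : ℝ) (μ₀ : ProbabilityMeasure ℝ) (ξ : ℝ) : ℂ :=
  if ξ = 0 then 0 else (1 - charFun (μ₀ : Measure ℝ) ξ) / ((|ξ| ^ α : ℝ) : ℂ) - (a₀ : ℂ)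

/-- The function `v₀*` with `1 - Re φ₀(ξ) = (a₀ + v₀*(ξ)) |ξ|^α`, normalized by `v₀*(0) = 0`. -/
def v0star (α a₀ : ℝ) (μ₀ : ProbabilityMeasure ℝ) (ξ : ℝ) : ℝ :=
  if ξ = 0 then 0 else (1 - (charFun (μ₀ : Measure ℝ) ξ).re) / |ξ| ^ α - a₀

/-- `M = a₀ + sup_{ξ ≥ 0} |v₀*(ξ)|`. -/
def constM (α a₀ : ℝ) (μ₀ : ProbabilityMeasure ℝ) : ℝ :=
  a₀ + sSup ((fun ξ => |v0star α a₀ μ₀ ξ|) '' Ici 0)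

/-- `sup_{0 ≤ x ≤ ξ} |v₀*(x)|`. -/
def v0bar (α a₀ : ℝ) (μ₀ : ProbabilityMeasure ℝ) (ξ : ℝ) : ℝ :=
  sSup ((fun x => |v0star α a₀ μ₀ x|) '' Icc 0 ξ)

/-- `d₁ = (3 / (8 M))^{1/α}`. -/
def d1 (α a₀ : ℝ) (μ₀ : ProbabilityMeasure ℝ) : ℝ :=
  (3 / (8 * constM α a₀ μ₀)) ^ (1 / α)

/-- `M_r = max_{x ≥ 0} x^{rα} exp (-(a₀ - η) x^α)`. -/
def constMr (α a₀ η r : ℝ) : ℝ :=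
  sSup ((fun x : ℝ => x ^ (r * α) * Real.exp (-(a₀ - η) * x ^ α)) '' Ici 0)

/-- `A_m = (1/2π) ∫₀^{2π} |sin θ|^m dθ`. -/
def constA (m : ℝ) : ℝ :=
  1 / (2 * Real.pi) * ∫ θ in (0 : ℝ)..(2 * Real.pi), |Real.sin θ| ^ m

/-- The weighted distance `χ_s(μ, ν) = sup_{ξ ≠ 0} |μ̂(ξ) - ν̂(ξ)| / |ξ|^s ∈ [0, ∞]`. -/
def chi (s : ℝ) (μ ν : ProbabilityMeasure ℝ) : ENNReal :=
  ⨆ (ξ : ℝ) (_ : ξ ≠ 0),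
    ENNReal.ofReal (‖charFun (μ : Measure ℝ) ξ - charFun (ν : Measure ℝ) ξ‖ / |ξ| ^ s)

/-- `sup_{ξ ≠ 0} |Im v₀(ξ)| / |ξ|^r`. -/
def supIm (α a₀ r : ℝ) (μ₀ : ProbabilityMeasure ℝ) : ℝ :=
  sSup ((fun ξ : ℝ => |(v0 α a₀ μ₀ ξ).im| / |ξ| ^ r) '' {ξ | ξ ≠ 0})

/-- The admissible choices of the auxiliary parameters: `η ∈ (0, a₀)`, `d ∈ (0, 1)` with
`(4/5) M² |x|^α + sup_{0 ≤ y ≤ |x|} |v₀*(y)| ≤ η` whenever `|x| ≤ (3d/(8M))^{1/α}`, and `ρ > 0` with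
`|v₀(x)| ≤ ρ |x|^δ` whenever `|x| ≤ d₁ d^{1/α}`. -/
structure Admissible (α a₀ δ : ℝ) (μ₀ : ProbabilityMeasure ℝ) (η d ρ : ℝ) : Prop where
  eta_pos : 0 < η
  eta_lt : η < a₀
  d_pos : 0 < d
  d_lt : d < 1
  small : ∀ x : ℝ, |x| ≤ (3 * d / (8 * constM α a₀ μ₀)) ^ (1 / α) →
    4 / 5 * constM α a₀ μ₀ ^ 2 * |x| ^ α + v0bar α a₀ μ₀ |x| ≤ η
  rho_pos : 0 < ρ
  v0_le : ∀ x : ℝ, |x| ≤ d1 α a₀ μ₀ * d ^ (1 / α) → ‖v0 α a₀ μ₀ x‖ ≤ ρ * |x| ^ δ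

end

end InelasticKac

/-! The symmetries θ ↦ -θ and θ ↦ π - θ make the gain term depend on Re φ only. So Im φ decays
exactly like e^{-t}, and Re φ solves the same equation by itself (`integral_charFun_mul_charFun`,
`IsKacSolution.im_charFun`).

For the real part ψ, a point ξ is regarded as a particle that splits at rate 1 into ξ s(θ) and ξ
c(θ). Such a collision conserves |ξ|^α, because s and c satisfy |s|^α + |c|^α = 1. Products of ψ
over a finite family of points are compared with sums of a solution h of the linearized equation: an
inequality |∏ ψ - g| ≤ ∑ h that holds at time 0 for every family with ∑ |x|^α = |ξ|^α propagates to
all times (`abs_sub_le_of_initial_bound`). No explicit series for the solution is needed. Powers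
|x|^r are eigenfunctions of the linearized gain operator, and they produce the rates 1 -
2A_{(1+p)r}.

What remains is a static estimate at time 0 with g = exp(-a₀|ξ|^α). If all points of the family are
small, expanding the logarithm bounds the difference by moments of orders α + δ and 2α, times
exp(-(a₀ - η)|ξ|^α) (`abs_prod_sub_exp_le`). If one point is large, the trivial bound 2 is dominated
by a moment (`abs_prod_sub_exp_le_of_exists`). The exponential factor depends only on the conserved
|ξ|^α, so it survives in the constants and absorbs the surplus power of |ξ| into M_r. -/

namespace InelasticKac

/-! ### The angular mean -/

section AngularMean

/-- The mean `(1/2π) ∫₀^{2π} f(θ) dθ`. -/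
noncomputable def angularMean (f : ℝ → ℝ) : ℝ :=
  1 / (2 * Real.pi) * ∫ θ in (0 : ℝ)..(2 * Real.pi), f θ

theorem continuous_sCoef {p : ℝ} (hp : 0 < p) : Continuous (sCoef p) :=
  Real.continuous_sin.mul (Real.continuous_sin.abs.rpow_const fun _ => Or.inr hp.le)

theorem continuous_cCoef {p : ℝ} (hp : 0 < p) : Continuous (cCoef p) :=
  Real.continuous_cos.mul (Real.continuous_cos.abs.rpow_const fun _ => Or.inr hp.le)

theorem angularMean_const (c : ℝ) : angularMean (fun _ => c) = c := by
  have := Real.pi_pos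
  simp only [angularMean, intervalIntegral.integral_const, smul_eq_mul]
  field_simp
  ring

theorem angularMean_add {f g : ℝ → ℝ} (hf : Continuous f) (hg : Continuous g) :
    angularMean (fun θ => f θ + g θ) = angularMean f + angularMean g := by
  simp only [angularMean]
  rw [intervalIntegral.integral_add (hf.intervalIntegrable _ _) (hg.intervalIntegrable _ _), mul_add]

theorem angularMean_const_mul (c : ℝ) (f : ℝ → ℝ) :
    angularMean (fun θ => c * f θ) = c * angularMean f := by
  simp only [angularMean]
  rw [intervalIntegral.integral_const_mul]
  ring

theorem abs_angularMean_le {f g : ℝ → ℝ} (hg : Continuous g) (h : ∀ θ, |f θ| ≤ g θ) :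
    |angularMean f| ≤ angularMean g := by
  have hpi : 0 ≤ 2 * Real.pi := by positivity
  simp only [angularMean]
  rw [abs_mul, abs_of_nonneg (by positivity : 0 ≤ 1 / (2 * Real.pi))]
  refine mul_le_mul_of_nonneg_left ?_ (by positivity)
  rw [← Real.norm_eq_abs]
  exact intervalIntegral.norm_integral_le_of_norm_le hpi
    (Eventually.of_forall fun θ _ => h θ) (hg.intervalIntegrable _ _)

theorem continuous_abs_sin_rpow {m : ℝ} (hm : 0 ≤ m) : Continuous fun θ => |Real.sin θ| ^ m :=
  Real.continuous_sin.abs.rpow_const fun _ => Or.inr hm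

theorem constA_nonneg (m : ℝ) : 0 ≤ constA m := by
  have hpi : 0 ≤ 2 * Real.pi := by positivity
  exact mul_nonneg (by positivity)
    (intervalIntegral.integral_nonneg hpi fun θ _ => Real.rpow_nonneg (abs_nonneg _) _)

theorem constA_anti {m m' : ℝ} (hm : 0 < m) (h : m ≤ m') : constA m' ≤ constA m := by
  have hpi : 0 ≤ 2 * Real.pi := by positivity
  refine mul_le_mul_of_nonneg_left ?_ (by positivity)
  refine intervalIntegral.integral_mono_on hpi
    ((continuous_abs_sin_rpow (hm.le.trans h)).intervalIntegrable _ _)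
    ((continuous_abs_sin_rpow hm.le).intervalIntegrable _ _) fun θ _ => ?_
  rcases eq_or_lt_of_le (abs_nonneg (Real.sin θ)) with h0 | h0
  · rw [← h0, Real.zero_rpow hm.ne', Real.zero_rpow (hm.trans_le h).ne']
  · exact Real.rpow_le_rpow_of_exponent_ge h0 (Real.abs_sin_le_one θ) h

theorem angularMean_abs_cos_rpow (m : ℝ) :
    angularMean (fun θ => |Real.cos θ| ^ m) = constA m := by
  have hper : Function.Periodic (fun θ => |Real.sin θ| ^ m) (2 * Real.pi) := fun θ => by
    simp only [Real.sin_add_two_pi]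
  have h1 : ∀ θ, |Real.cos θ| ^ m = (fun θ => |Real.sin θ| ^ m) (θ + Real.pi / 2) := fun θ => by
    simp only [Real.sin_add_pi_div_two]
  simp only [angularMean, constA, h1]
  rw [intervalIntegral.integral_comp_add_right (fun θ => |Real.sin θ| ^ m)]
  have := hper.intervalIntegral_add_eq (Real.pi / 2) 0
  rw [zero_add] at this
  rw [zero_add, add_comm (2 * Real.pi), this]

theorem abs_sCoef {p : ℝ} (hp : 0 < p) (θ : ℝ) : |sCoef p θ| = |Real.sin θ| ^ (1 + p) := by
  rw [sCoef, abs_mul, abs_of_nonneg (Real.rpow_nonneg (abs_nonneg _) _),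
    Real.rpow_one_add' (abs_nonneg _) (by linarith)]

theorem abs_cCoef {p : ℝ} (hp : 0 < p) (θ : ℝ) : |cCoef p θ| = |Real.cos θ| ^ (1 + p) := by
  rw [cCoef, abs_mul, abs_of_nonneg (Real.rpow_nonneg (abs_nonneg _) _),
    Real.rpow_one_add' (abs_nonneg _) (by linarith)]

theorem abs_mul_sCoef_rpow {p : ℝ} (hp : 0 < p) (x r θ : ℝ) :
    |x * sCoef p θ| ^ r = |x| ^ r * |Real.sin θ| ^ ((1 + p) * r) := by
  rw [abs_mul, Real.mul_rpow (abs_nonneg _) (abs_nonneg _), abs_sCoef hp,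
    ← Real.rpow_mul (abs_nonneg _)]

theorem abs_mul_cCoef_rpow {p : ℝ} (hp : 0 < p) (x r θ : ℝ) :
    |x * cCoef p θ| ^ r = |x| ^ r * |Real.cos θ| ^ ((1 + p) * r) := by
  rw [abs_mul, Real.mul_rpow (abs_nonneg _) (abs_nonneg _), abs_cCoef hp,
    ← Real.rpow_mul (abs_nonneg _)]

/-- The quantity `|x|^α` is conserved in a collision. -/
theorem abs_rpow_sCoef_add_cCoef {p : ℝ} (hp : 0 < p) {α : ℝ} (hα : α = 2 / (1 + p)) (x θ : ℝ) :
    |x * sCoef p θ| ^ α + |x * cCoef p θ| ^ α = |x| ^ α := by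
  have h2 : (1 + p) * α = 2 := by
    rw [hα]
    field_simp
  rw [abs_mul_sCoef_rpow hp, abs_mul_cCoef_rpow hp, h2, ← mul_add]
  simp

theorem angularMean_abs_rpow {p : ℝ} (hp : 0 < p) (x r : ℝ) (hr : 0 ≤ r) :
    angularMean (fun θ => |x * sCoef p θ| ^ r + |x * cCoef p θ| ^ r)
      = 2 * constA ((1 + p) * r) * |x| ^ r := by
  have hm : 0 ≤ (1 + p) * r := by positivity
  simp only [abs_mul_sCoef_rpow hp, abs_mul_cCoef_rpow hp]
  rw [angularMean_add ((continuous_abs_sin_rpow hm).const_mul _)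
    ((Real.continuous_cos.abs.rpow_const fun _ => Or.inr hm).const_mul _),
    angularMean_const_mul, angularMean_const_mul, angularMean_abs_cos_rpow]
  simp only [angularMean, constA]
  ring

end AngularMean

/-! ### Comparison with the linearized equation -/

section Comparison

/-- Leibniz rule in the form of one particle colliding while the others stay; multisets allow
repeated positions. -/
theorem hasDerivAt_multiset_prod_map {ι : Type*} [DecidableEq ι] (b : Multiset ι)
    {f : ℝ → ι → ℝ} {f' : ι → ℝ} {t : ℝ} (h : ∀ x, HasDerivAt (fun t => f t x) (f' x) t) :
    HasDerivAt (fun t => (b.map (f t)).prod)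
      (b.map fun x => ((b.erase x).map (f t)).prod * f' x).sum t := by
  induction b using Multiset.induction_on with
  | empty => simpa using hasDerivAt_const t (1 : ℝ)
  | cons a s ih =>
    simp only [Multiset.map_cons, Multiset.prod_cons, Multiset.sum_cons, Multiset.erase_cons_head]
    refine ((h a).fun_mul ih).congr_deriv ?_
    have : s.map (fun x => (((a ::ₘ s).erase x).map (f t)).prod * f' x)
        = s.map (fun x => f t a * (((s.erase x).map (f t)).prod * f' x)) := by
      refine Multiset.map_congr rfl fun x hx => ?_
      -- As x lies in s, the erased copy may be taken from s even when x = a.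
      rw [Multiset.erase_cons_tail_of_mem hx, Multiset.map_cons, Multiset.prod_cons, mul_assoc]
    rw [this, Multiset.sum_map_mul_left]
    ring

theorem hasDerivAt_multiset_sum_map {ι : Type*} (b : Multiset ι)
    {f : ℝ → ι → ℝ} {f' : ι → ℝ} {t : ℝ} (h : ∀ x, HasDerivAt (fun t => f t x) (f' x) t) :
    HasDerivAt (fun t => (b.map (f t)).sum) (b.map f').sum t := by
  induction b using Multiset.induction_on with
  | empty => simpa using hasDerivAt_const t (0 : ℝ)
  | cons a s ih =>
    simp only [Multiset.map_cons, Multiset.sum_cons]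
    exact (h a).fun_add ih

theorem abs_multiset_prod_map_le_one {ι : Type*} (b : Multiset ι) {f : ι → ℝ}
    (h : ∀ x, |f x| ≤ 1) : |(b.map f).prod| ≤ 1 := by
  induction b using Multiset.induction_on with
  | empty => simp
  | cons a s ih =>
    rw [Multiset.map_cons, Multiset.prod_cons, abs_mul]
    exact mul_le_one₀ (h a) (abs_nonneg _) ih

/-- A function on `[0, ∞)` whose derivative is dominated by that of `B` and that starts below `B`
stays below `B`. -/
theorem abs_le_of_abs_deriv_le {F F' B B' : ℝ → ℝ}
    (hF : ContinuousOn F (Ici 0)) (hF' : ∀ t, 0 < t → HasDerivAt F (F' t) t)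
    (hB : ContinuousOn B (Ici 0)) (hB' : ∀ t, 0 < t → HasDerivAt B (B' t) t)
    (hle : ∀ t, 0 < t → |F' t| ≤ B' t) (h0 : |F 0| ≤ B 0) {t : ℝ} (ht : 0 ≤ t) :
    |F t| ≤ B t := by
  have key : ∀ {D D' : ℝ → ℝ}, ContinuousOn D (Ici 0) → (∀ t, 0 < t → HasDerivAt D (D' t) t) →
      (∀ t, 0 < t → 0 ≤ D' t) → D 0 ≤ D t := by
    intro D D' hD hD' hpos
    refine monotoneOn_of_deriv_nonneg (convex_Ici 0) hD ?_ ?_ self_mem_Ici ht ht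
    · rw [interior_Ici]
      exact fun s hs => (hD' s hs).differentiableAt.differentiableWithinAt
    · rw [interior_Ici]
      intro s hs
      rw [(hD' s hs).deriv]
      exact hpos s hs
  have h1 := key (hB.sub hF) (fun s hs => (hB' s hs).sub (hF' s hs)) fun s hs => by
    have := (abs_le.1 (hle s hs)).2
    linarith
  have h2 := key (hB.add hF) (fun s hs => (hB' s hs).add (hF' s hs)) fun s hs => by
    have := (abs_le.1 (hle s hs)).1
    linarith
  simp only [Pi.sub_apply, Pi.add_apply] at h1 h2
  have h3 := abs_le.1 h0
  exact abs_le.2 ⟨by linarith, by linarith⟩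

variable {p α : ℝ}

/-- `ψ` solves the Kac equation for real-valued characteristic functions. -/
structure IsRealKacSolution (p : ℝ) (ψ : ℝ → ℝ → ℝ) : Prop where
  abs_le_one : ∀ t x, |ψ t x| ≤ 1
  continuous : ∀ t, Continuous (ψ t)
  continuousOn : ∀ x, ContinuousOn (fun t => ψ t x) (Ici 0)
  hasDerivAt : ∀ x t, 0 < t → HasDerivAt (fun t => ψ t x)
    (angularMean (fun θ => ψ t (x * sCoef p θ) * ψ t (x * cCoef p θ)) - ψ t x) t

/-- `h` is a nonnegative solution of the Kac equation linearized at the constant `1`. -/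
structure IsLinearKacSolution (p : ℝ) (h : ℝ → ℝ → ℝ) : Prop where
  nonneg : ∀ t x, 0 ≤ h t x
  continuous : ∀ t, Continuous (h t)
  continuousOn : ∀ x, ContinuousOn (fun t => h t x) (Ici 0)
  hasDerivAt : ∀ x t, 0 < t → HasDerivAt (fun t => h t x)
    (angularMean (fun θ => h t (x * sCoef p θ) + h t (x * cCoef p θ)) - h t x) t

/-- Bound for products over finite families of positions, with the error term coming from the
families that have undergone at least `k` collisions. -/
theorem abs_prod_sub_le_add (hp : 0 < p) (hα : α = 2 / (1 + p)) {ψ h : ℝ → ℝ → ℝ}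
    (hψ : IsRealKacSolution p ψ) (hh : IsLinearKacSolution p h) {w g : ℝ} (hg : |g| ≤ 1)
    (h0 : ∀ b : Multiset ℝ, (b.map fun x => |x| ^ α).sum = w →
      |(b.map (ψ 0)).prod - g| ≤ (b.map (h 0)).sum) (k : ℕ) :
    ∀ b : Multiset ℝ, b ≠ 0 → (b.map fun x => |x| ^ α).sum = w → ∀ t, 0 ≤ t →
      |(b.map (ψ t)).prod - g| ≤ (b.map (h t)).sum
        + 2 * (b.card * Real.exp t / (b.card + k)) := by
  classical
  -- In a family of n particles each splitting at rate 1, the mean size at time t is n e^t. By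
  -- Markov's inequality, size n + k is reached with probability at most n e^t / (n + k), and there
  -- the trivial bound 2 is used. For k = 0 this is 2 e^t ≥ 2.
  induction k with
  | zero =>
    intro b hb _ t ht
    have hc : (b.card : ℝ) ≠ 0 := by exact_mod_cast (Multiset.card_pos.2 hb).ne'
    have h1 := abs_multiset_prod_map_le_one b (hψ.abs_le_one t)
    have h2 : 0 ≤ (b.map (h t)).sum := Multiset.sum_nonneg fun y hy => by
      obtain ⟨x, -, rfl⟩ := Multiset.mem_map.1 hy
      exact hh.nonneg t x
    have h3 := Real.one_le_exp ht
    have h4 := abs_sub (b.map (ψ t)).prod g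
    have h5 : (b.card : ℝ) * Real.exp t / (b.card + (0 : ℕ)) = Real.exp t := by
      rw [Nat.cast_zero, add_zero]
      field_simp
    rw [h5]
    linarith
  | succ k ih =>
    intro b hb hw t ht
    set n : ℝ := (b.card : ℝ) with hn
    have hnpos : 0 < n := by
      rw [hn]
      exact_mod_cast Multiset.card_pos.2 hb
    let u : ℝ → ℝ := fun t => (b.map (ψ t)).prod
    let H : ℝ → ℝ := fun t => (b.map (h t)).sum
    let qψ : ℝ → ℝ → ℝ := fun t x =>
      angularMean (fun θ => ψ t (x * sCoef p θ) * ψ t (x * cCoef p θ))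
    let qh : ℝ → ℝ → ℝ := fun t x =>
      angularMean (fun θ => h t (x * sCoef p θ) + h t (x * cCoef p θ))
    have hu : ∀ s, 0 < s → HasDerivAt u
        (b.map fun x => ((b.erase x).map (ψ s)).prod * (qψ s x - ψ s x)).sum s := fun s hs =>
      hasDerivAt_multiset_prod_map b fun x => hψ.hasDerivAt x s hs
    have hH : ∀ s, 0 < s → HasDerivAt H (b.map fun x => qh s x - h s x).sum s := fun s hs =>
      hasDerivAt_multiset_sum_map b fun x => hh.hasDerivAt x s hs
    have huc : ContinuousOn u (Ici 0) :=
      continuousOn_multiset_prod b fun x _ => hψ.continuousOn x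
    have hHc : ContinuousOn H (Ici 0) :=
      continuousOn_multiset_sum b fun x _ => hh.continuousOn x
    have hE : ∀ c s : ℝ, HasDerivAt (fun t => Real.exp (c * t)) (c * Real.exp (c * s)) s :=
      fun c s => by
        have := ((hasDerivAt_id s).const_mul c).exp
        simpa [mul_comm] using this
    have hEc : ∀ c : ℝ, ContinuousOn (fun t => Real.exp (c * t)) (Ici 0) := fun c => by fun_prop
    -- Chosen so that (n + 1) c e^{(n+1)s} is e^{ns} times n copies of the error that the induction
    -- hypothesis gives for n + 1 particles. The factor e^{nt} below removes the loss term.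
    set c : ℝ := 2 * n / (n + (k + 1 : ℕ)) with hc
    have main := abs_le_of_abs_deriv_le
      (F := fun t => Real.exp (n * t) * (u t - g))
      (B := fun t => Real.exp (n * t) * H t + c * Real.exp ((n + 1) * t))
      ((hEc n).mul (huc.sub continuousOn_const))
      (fun s hs => (hE n s).fun_mul ((hu s hs).sub_const g))
      (((hEc n).mul hHc).add (continuousOn_const.mul (hEc (n + 1))))
      (fun s hs => ((hE n s).fun_mul (hH s hs)).fun_add ((hE (n + 1) s).const_mul c))
      ?_ ?_ ht
    · have hEpos := Real.exp_pos (n * t)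
      simp only [abs_mul, abs_of_pos hEpos] at main
      have h1 : Real.exp ((n + 1) * t) = Real.exp (n * t) * Real.exp t := by
        rw [← Real.exp_add]
        ring_nf
      rw [h1] at main
      have h2 : Real.exp (n * t) * |u t - g|
          ≤ Real.exp (n * t) * (H t + 2 * (n * Real.exp t / (n + (k + 1 : ℕ)))) := by
        refine main.trans (le_of_eq ?_)
        rw [hc]
        ring
      exact le_of_mul_le_mul_left h2 hEpos
    · intro s hs
      have hEpos := Real.exp_pos (n * s)
      have h1 : Real.exp ((n + 1) * s) = Real.exp (n * s) * Real.exp s := by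
        rw [← Real.exp_add]
        ring_nf
      have hpoint : ∀ x ∈ b, |((b.erase x).map (ψ s)).prod * qψ s x - g|
          ≤ qh s x + H s - h s x + 2 * ((n + 1) * Real.exp s / (n + 1 + k)) := by
        intro x hx
        have hcs : Continuous fun θ => x * sCoef p θ := (continuous_sCoef hp).const_mul x
        have hcc : Continuous fun θ => x * cCoef p θ := (continuous_cCoef hp).const_mul x
        have hψs : Continuous fun θ => ψ s (x * sCoef p θ) * ψ s (x * cCoef p θ) :=
          ((hψ.continuous s).comp hcs).mul ((hψ.continuous s).comp hcc)
        have hhs : Continuous fun θ => h s (x * sCoef p θ) + h s (x * cCoef p θ) :=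
          ((hh.continuous s).comp hcs).add ((hh.continuous s).comp hcc)
        set P := ((b.erase x).map (ψ s)).prod with hP
        have e1 : P * qψ s x - g = angularMean (fun θ =>
            P * (ψ s (x * sCoef p θ) * ψ s (x * cCoef p θ)) + -g) := by
          rw [angularMean_add (hψs.const_mul P) continuous_const, angularMean_const_mul,
            angularMean_const]
          ring
        have e2 : qh s x + H s - h s x + 2 * ((n + 1) * Real.exp s / (n + 1 + k))
            = angularMean (fun θ => (h s (x * sCoef p θ) + h s (x * cCoef p θ))
              + (H s - h s x + 2 * ((n + 1) * Real.exp s / (n + 1 + k)))) := by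
          rw [angularMean_add hhs continuous_const, angularMean_const]
          ring
        rw [e1, e2]
        refine abs_angularMean_le (hhs.add continuous_const) fun θ => ?_
        have hsplit := fun f : ℝ → ℝ => Multiset.sum_map_erase (m := b) (f := f) hx
        -- The collision conserves ∑ |x|^α and raises the cardinality by one, so the induction
        -- hypothesis applies to the new family.
        have := ih (x * sCoef p θ ::ₘ x * cCoef p θ ::ₘ b.erase x) (by simp) (by
          simp only [Multiset.map_cons, Multiset.sum_cons]
          rw [← add_assoc, abs_rpow_sCoef_add_cCoef hp hα, ← hw]
          exact hsplit fun x => |x| ^ α) s hs.le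
        have hcard : (((x * sCoef p θ ::ₘ x * cCoef p θ ::ₘ b.erase x).card : ℕ) : ℝ) = n + 1 := by
          rw [Multiset.card_cons, Multiset.card_cons, Multiset.card_erase_add_one hx]
          push_cast
          rfl
        rw [hcard] at this
        simp only [Multiset.map_cons, Multiset.sum_cons, Multiset.prod_cons] at this
        have hs2 := hsplit (h s)
        have e3 : P * (ψ s (x * sCoef p θ) * ψ s (x * cCoef p θ)) + -g
            = ψ s (x * sCoef p θ) * (ψ s (x * cCoef p θ) * P) - g := by ring
        rw [e3]
        refine this.trans (le_of_eq ?_)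
        change _ = _ + ((b.map (h s)).sum - _ + _)
        rw [← hs2]
        ring
      -- Restoring the erased factor turns each loss term into the whole product `u s`, so the n
      -- losses add up to n u.
      have hsum : (b.map fun x => ((b.erase x).map (ψ s)).prod * (qψ s x - ψ s x)).sum
          = (b.map fun x => ((b.erase x).map (ψ s)).prod * qψ s x - g).sum - n * (u s - g) := by
        have : n * (u s - g) = (b.map fun _ => u s - g).sum := by simp [hn]
        rw [this, ← Multiset.sum_map_sub]
        congr 1
        refine Multiset.map_congr rfl fun x hx => ?_
        have := Multiset.prod_map_erase (m := b) (f := ψ s) hx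
        change _ = _ - ((b.map (ψ s)).prod - g)
        rw [← this]
        ring
      have habs : |(b.map fun x => ((b.erase x).map (ψ s)).prod * qψ s x - g).sum|
          ≤ (b.map fun x => (qh s x - h s x)).sum + n * (H s +
            2 * ((n + 1) * Real.exp s / (n + 1 + k))) := by
        have : n * (H s + 2 * ((n + 1) * Real.exp s / (n + 1 + k)))
            = (b.map fun _ => H s + 2 * ((n + 1) * Real.exp s / (n + 1 + k))).sum := by
          rw [Multiset.map_const', Multiset.sum_replicate, nsmul_eq_mul]
        rw [this, ← Multiset.sum_map_add]
        refine Multiset.abs_sum_le_sum_abs.trans ?_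
        rw [Multiset.map_map]
        refine Multiset.sum_map_le_sum_map _ _ fun x hx => ?_
        have := hpoint x hx
        simp only [Function.comp]
        linarith
      rw [hsum, h1]
      have e4 : n * Real.exp (n * s) * (u s - g) + Real.exp (n * s) *
          ((b.map fun x => ((b.erase x).map (ψ s)).prod * qψ s x - g).sum - n * (u s - g))
          = Real.exp (n * s) * (b.map fun x => ((b.erase x).map (ψ s)).prod * qψ s x - g).sum := by
        ring
      rw [e4, abs_mul, abs_of_pos hEpos]
      refine (mul_le_mul_of_nonneg_left habs hEpos.le).trans (le_of_eq ?_)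
      rw [hc]
      push_cast
      rw [add_right_comm n 1 (k : ℝ), add_assoc n (k : ℝ) 1]
      ring
    · have := h0 b hw
      have hcpos : 0 ≤ c := by positivity
      simp only [mul_zero, Real.exp_zero, one_mul, mul_one]
      exact this.trans (le_add_of_nonneg_right hcpos)

/-- Apply the family bound to the singleton {ξ} and let k → ∞. -/
theorem abs_sub_le_of_initial_bound (hp : 0 < p) (hα : α = 2 / (1 + p)) {ψ h : ℝ → ℝ → ℝ}
    (hψ : IsRealKacSolution p ψ) (hh : IsLinearKacSolution p h) {g : ℝ} (hg : |g| ≤ 1) (ξ : ℝ)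
    (h0 : ∀ b : Multiset ℝ, (b.map fun x => |x| ^ α).sum = |ξ| ^ α →
      |(b.map (ψ 0)).prod - g| ≤ (b.map (h 0)).sum) {t : ℝ} (ht : 0 ≤ t) :
    |ψ t ξ - g| ≤ h t ξ := by
  have hlim : Tendsto (fun k : ℕ => h t ξ + 2 * (Real.exp t / (1 + k))) atTop
      (𝓝 (h t ξ + 2 * 0)) := by
    refine tendsto_const_nhds.add (Tendsto.const_mul _ ?_)
    exact tendsto_const_nhds.div_atTop
      (tendsto_atTop_add_const_left _ _ tendsto_natCast_atTop_atTop)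
  rw [mul_zero, add_zero] at hlim
  refine ge_of_tendsto hlim (Eventually.of_forall fun k => ?_)
  simpa using abs_prod_sub_le_add hp hα hψ hh hg h0 k {ξ} (by simp) (by simp) t ht

/-- By `angularMean_abs_rpow`, |x|^r is an eigenfunction of the linearized gain operator with
eigenvalue 2A_{(1+p)r}; the loss term subtracts 1. -/
theorem isLinearKacSolution_rpow (hp : 0 < p) {c r : ℝ} (hc : 0 ≤ c) (hr : 0 ≤ r) :
    IsLinearKacSolution p
      (fun t x => c * Real.exp (-t * (1 - 2 * constA ((1 + p) * r))) * |x| ^ r) where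
  nonneg t x := by positivity
  continuous t := continuous_const.mul (continuous_abs.rpow_const fun _ => Or.inr hr)
  continuousOn x := by fun_prop
  hasDerivAt x t _ := by
    simp only [← mul_add]
    rw [angularMean_const_mul, angularMean_abs_rpow hp x r hr]
    have := ((((hasDerivAt_id t).neg.mul_const
      (1 - 2 * constA ((1 + p) * r))).exp.const_mul c).mul_const (|x| ^ r))
    refine this.congr_deriv ?_
    simp only [Pi.neg_apply, id]
    ring

theorem IsLinearKacSolution.add (hp : 0 < p) {h₁ h₂ : ℝ → ℝ → ℝ} (H₁ : IsLinearKacSolution p h₁)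
    (H₂ : IsLinearKacSolution p h₂) : IsLinearKacSolution p (fun t x => h₁ t x + h₂ t x) where
  nonneg t x := add_nonneg (H₁.nonneg t x) (H₂.nonneg t x)
  continuous t := (H₁.continuous t).add (H₂.continuous t)
  continuousOn x := (H₁.continuousOn x).add (H₂.continuousOn x)
  hasDerivAt x t ht := by
    refine ((H₁.hasDerivAt x t ht).fun_add (H₂.hasDerivAt x t ht)).congr_deriv ?_
    have hcs : Continuous fun θ => x * sCoef p θ := (continuous_sCoef hp).const_mul x
    have hcc : Continuous fun θ => x * cCoef p θ := (continuous_cCoef hp).const_mul x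
    have := angularMean_add
      (f := fun θ => h₁ t (x * sCoef p θ) + h₁ t (x * cCoef p θ))
      (g := fun θ => h₂ t (x * sCoef p θ) + h₂ t (x * cCoef p θ))
      (((H₁.continuous t).comp hcs).add ((H₁.continuous t).comp hcc))
      (((H₂.continuous t).comp hcs).add ((H₂.continuous t).comp hcc))
    simp only [add_add_add_comm (h₁ t _) (h₂ t _)]
    rw [this]
    ring

end Comparison

end InelasticKac

namespace InelasticKac

/-! ### Real and imaginary parts of a solution -/

section RealImaginary

variable {p : ℝ}

theorem sCoef_neg (θ : ℝ) : sCoef p (-θ) = -sCoef p θ := by simp [sCoef]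

theorem cCoef_neg (θ : ℝ) : cCoef p (-θ) = cCoef p θ := by simp [cCoef]

theorem sCoef_pi_sub (θ : ℝ) : sCoef p (Real.pi - θ) = sCoef p θ := by simp [sCoef]

theorem cCoef_pi_sub (θ : ℝ) : cCoef p (Real.pi - θ) = -cCoef p θ := by simp [cCoef]

theorem integral_comp_sub_of_periodic {f : ℝ → ℂ} (hf : Function.Periodic f (2 * Real.pi)) (a : ℝ) :
    ∫ θ in (0 : ℝ)..(2 * Real.pi), f (a - θ) = ∫ θ in (0 : ℝ)..(2 * Real.pi), f θ := by
  rw [intervalIntegral.integral_comp_sub_left (fun θ => f θ), sub_zero]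
  have := hf.intervalIntegral_add_eq (a - 2 * Real.pi) 0
  rwa [zero_add, sub_add_cancel] at this

/-- By the symmetries of the collision kernel only the real parts contribute to the gain term. -/
theorem integral_charFun_mul_charFun (hp : 0 < p) (μ : ProbabilityMeasure ℝ) (x : ℝ) :
    ∫ θ in (0 : ℝ)..(2 * Real.pi),
        charFun (μ : Measure ℝ) (x * sCoef p θ) * charFun (μ : Measure ℝ) (x * cCoef p θ)
      = ((∫ θ in (0 : ℝ)..(2 * Real.pi), (charFun (μ : Measure ℝ) (x * sCoef p θ)).re
        * (charFun (μ : Measure ℝ) (x * cCoef p θ)).re : ℝ) : ℂ) := by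
  set φ : ℝ → ℂ := charFun (μ : Measure ℝ) with hφ
  have hφc : Continuous φ := continuous_charFun
  let f : ℝ → ℝ → ℝ → ℂ := fun i j θ => φ (i * (x * sCoef p θ)) * φ (j * (x * cCoef p θ))
  have hsc : Continuous fun θ => x * sCoef p θ := (continuous_sCoef hp).const_mul x
  have hcc : Continuous fun θ => x * cCoef p θ := (continuous_cCoef hp).const_mul x
  have hfc : ∀ i j, Continuous (f i j) := fun i j =>
    (hφc.comp (hsc.const_mul i)).mul (hφc.comp (hcc.const_mul j))
  have hfi : ∀ i j, IntervalIntegrable (f i j) volume 0 (2 * Real.pi) := fun i j =>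
    (hfc i j).intervalIntegrable _ _
  have hper : ∀ i j, Function.Periodic (f i j) (2 * Real.pi) := fun i j θ => by
    simp only [f, sCoef, cCoef, Real.sin_add_two_pi, Real.cos_add_two_pi]
  have hs : ∀ i j, ∫ θ in (0 : ℝ)..(2 * Real.pi), f (-i) j θ
      = ∫ θ in (0 : ℝ)..(2 * Real.pi), f i j θ := fun i j => by
    rw [← integral_comp_sub_of_periodic (hper i j) 0]
    simp only [f, zero_sub, sCoef_neg, cCoef_neg, mul_neg, neg_mul]
  have hc : ∀ i j, ∫ θ in (0 : ℝ)..(2 * Real.pi), f i (-j) θ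
      = ∫ θ in (0 : ℝ)..(2 * Real.pi), f i j θ := fun i j => by
    rw [← integral_comp_sub_of_periodic (hper i j) Real.pi]
    simp only [f, sCoef_pi_sub, cCoef_pi_sub, mul_neg, neg_mul]
  -- Writing each real part as half the sum of φ(y) and φ(-y) gives four sign choices, whose
  -- integrals agree by `hs` and `hc`.
  have hre : ∀ θ, (((φ (x * sCoef p θ)).re * (φ (x * cCoef p θ)).re : ℝ) : ℂ)
      = 1 / 4 * ((f 1 1 θ + f (-1) 1 θ) + (f 1 (-1) θ + f (-1) (-1) θ)) := fun θ => by
    have hneg : ∀ y, φ (-y) = (starRingEnd ℂ) (φ y) := fun y => charFun_neg y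
    simp only [f, one_mul, neg_mul, hneg]
    push_cast
    rw [Complex.re_eq_add_conj, Complex.re_eq_add_conj]
    ring
  rw [← intervalIntegral.integral_ofReal]
  simp only [hre]
  rw [intervalIntegral.integral_const_mul, intervalIntegral.integral_add
    ((hfi _ _).add (hfi _ _)) ((hfi _ _).add (hfi _ _)), intervalIntegral.integral_add (hfi _ _)
    (hfi _ _), intervalIntegral.integral_add (hfi _ _) (hfi _ _), hs, hs, hc]
  simp only [f, one_mul]
  ring

theorem IsKacSolution.hasDerivAt_charFun (hp : 0 < p) {μ₀ : ProbabilityMeasure ℝ}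
    {μ : ℝ → ProbabilityMeasure ℝ} (hμ : IsKacSolution p μ₀ μ) (x t : ℝ) (ht : 0 < t) :
    HasDerivAt (fun t => charFun (μ t : Measure ℝ) x)
      ((angularMean (fun θ => (charFun (μ t : Measure ℝ) (x * sCoef p θ)).re
        * (charFun (μ t : Measure ℝ) (x * cCoef p θ)).re) : ℝ)
        - charFun (μ t : Measure ℝ) x) t := by
  refine (hμ.hasDerivAt x t ht).congr_deriv ?_
  rw [integral_charFun_mul_charFun hp]
  simp only [angularMean]
  push_cast
  rfl

theorem IsKacSolution.isRealKacSolution (hp : 0 < p) {μ₀ : ProbabilityMeasure ℝ}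
    {μ : ℝ → ProbabilityMeasure ℝ} (hμ : IsKacSolution p μ₀ μ) :
    IsRealKacSolution p (fun t x => (charFun (μ t : Measure ℝ) x).re) where
  abs_le_one t x := (Complex.abs_re_le_norm _).trans (norm_charFun_le_one x)
  continuous t := Complex.continuous_re.comp continuous_charFun
  continuousOn x := Complex.continuous_re.comp_continuousOn (hμ.continuousOn x)
  hasDerivAt x t ht := by
    have := Complex.reCLM.hasFDerivAt.comp_hasDerivAt t (hμ.hasDerivAt_charFun hp x t ht)
    refine this.congr_deriv ?_
    simp

/-- The gain term is real, so only the loss term acts on the imaginary part. -/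
theorem IsKacSolution.im_charFun (hp : 0 < p) {μ₀ : ProbabilityMeasure ℝ}
    {μ : ℝ → ProbabilityMeasure ℝ} (hμ : IsKacSolution p μ₀ μ) (x : ℝ) {t : ℝ} (ht : 0 ≤ t) :
    (charFun (μ t : Measure ℝ) x).im = Real.exp (-t) * (charFun (μ₀ : Measure ℝ) x).im := by
  let I : ℝ → ℝ := fun t => (charFun (μ t : Measure ℝ) x).im
  have hI : ContinuousOn I (Ici 0) := Complex.continuous_im.comp_continuousOn (hμ.continuousOn x)
  have hI' : ∀ t, 0 < t → HasDerivAt I (-I t) t := fun t ht => by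
    have := Complex.imCLM.hasFDerivAt.comp_hasDerivAt t (hμ.hasDerivAt_charFun hp x t ht)
    refine this.congr_deriv ?_
    simp [I]
  have := abs_le_of_abs_deriv_le (F := fun t => Real.exp t * I t - I 0) (B := fun _ => 0)
    ((Real.continuous_exp.continuousOn.mul hI).sub continuousOn_const)
    (fun s hs => ((Real.hasDerivAt_exp s).fun_mul (hI' s hs)).sub_const _)
    continuousOn_const (fun s _ => hasDerivAt_const s (0 : ℝ)) (fun s _ => by simp) (by simp) ht
  have h0 : Real.exp t * I t = I 0 := by
    have := abs_nonpos_iff.1 this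
    linarith
  have hI0 : I 0 = (charFun (μ₀ : Measure ℝ) x).im := by simp only [I, hμ.initial]
  rw [← hI0, ← h0, ← mul_assoc, ← Real.exp_add]
  simp [I]

end RealImaginary

/-! ### The initial datum -/

section Initial

/-- The derivative of z + log(1 - z) + (4/5)z² is z(3 - 8z)/(5(1 - z)), nonnegative on [0, 3/8].
This links the constant 4/5 to the threshold 3/8 in d₁. -/
theorem abs_add_log_one_sub_le {z : ℝ} (h0 : 0 ≤ z) (h1 : z ≤ 3 / 8) :
    |z + Real.log (1 - z)| ≤ 4 / 5 * z ^ 2 := by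
  have hup : z + Real.log (1 - z) ≤ 0 := by
    have := Real.log_le_sub_one_of_pos (by linarith : 0 < 1 - z)
    linarith
  have hd : ∀ y ∈ Icc (0 : ℝ) (3 / 8), HasDerivAt
      (fun y => y + Real.log (1 - y) + 4 / 5 * y ^ 2) (1 + -1 / (1 - y) + 4 / 5 * (2 * y)) y := by
    intro y hy
    have hne : (1 - y) ≠ 0 := by have := hy.2; intro h; linarith
    have := ((hasDerivAt_id y).fun_add (((hasDerivAt_id y).const_sub 1).log hne)).fun_add
      (((hasDerivAt_id y).fun_pow 2).const_mul (4 / 5))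
    simpa using this
  have hm : MonotoneOn (fun y => y + Real.log (1 - y) + 4 / 5 * y ^ 2) (Icc 0 (3 / 8)) := by
    refine monotoneOn_of_deriv_nonneg (convex_Icc _ _)
      (fun y hy => (hd y hy).continuousAt.continuousWithinAt)
      (fun y hy => (hd y (interior_subset hy)).differentiableAt.differentiableWithinAt)
      fun y hy => ?_
    have hy' := interior_subset hy
    rw [(hd y hy').deriv]
    have hpos : 0 < 1 - y := by have := hy'.2; linarith
    have : 1 + -1 / (1 - y) + 4 / 5 * (2 * y) = y * (3 - 8 * y) / (5 * (1 - y)) := by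
      field_simp
      ring
    rw [this]
    have := hy'.1
    have : 0 ≤ 3 - 8 * y := by have := hy'.2; linarith
    positivity
  have := hm (left_mem_Icc.2 (by norm_num)) ⟨h0, h1⟩ h0
  simp only [sub_zero, Real.log_one] at this
  rw [abs_of_nonpos hup]
  linarith

/-- The factor |x| will receive the sharp moment bound and the exponential a crude one, so no
quadratic remainder appears. -/
theorem abs_exp_sub_one_le_mul_exp (x : ℝ) : |Real.exp x - 1| ≤ |x| * Real.exp |x| := by
  have h1 := Real.add_one_le_exp x
  have h2 := Real.add_one_le_exp (-x)
  have h3 := Real.exp_pos x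
  have h4 : Real.exp x * Real.exp (-x) = 1 := by rw [← Real.exp_add]; simp
  rcases le_total 0 x with h | h
  · rw [abs_of_nonneg h, abs_of_nonneg (by linarith)]
    nlinarith
  · rw [abs_of_nonpos h, abs_of_nonpos (sub_nonpos.2 (Real.exp_le_one_iff.2 h))]
    have := Real.one_le_exp (neg_nonneg.2 h)
    nlinarith

variable {α a₀ δ : ℝ} {μ₀ : ProbabilityMeasure ℝ}

theorem v0star_eq_re (ξ : ℝ) : v0star α a₀ μ₀ ξ = (v0 α a₀ μ₀ ξ).re := by
  unfold v0star v0
  split_ifs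
  · simp
  · rw [Complex.sub_re, Complex.div_ofReal_re]
    simp

theorem abs_v0star_le (ξ : ℝ) : |v0star α a₀ μ₀ ξ| ≤ ‖v0 α a₀ μ₀ ξ‖ := by
  rw [v0star_eq_re]
  exact Complex.abs_re_le_norm _

theorem v0star_neg (ξ : ℝ) : v0star α a₀ μ₀ (-ξ) = v0star α a₀ μ₀ ξ := by
  unfold v0star
  rw [charFun_neg]
  simp

theorem v0star_abs (ξ : ℝ) : v0star α a₀ μ₀ |ξ| = v0star α a₀ μ₀ ξ := by
  rcases abs_choice ξ with h | h <;> rw [h]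
  exact v0star_neg ξ

theorem one_sub_re_charFun (hα : 0 < α) (ξ : ℝ) :
    1 - (charFun (μ₀ : Measure ℝ) ξ).re = (a₀ + v0star α a₀ μ₀ ξ) * |ξ| ^ α := by
  unfold v0star
  split_ifs with h
  · rw [h, abs_zero, Real.zero_rpow hα.ne']
    simp
  · have : |ξ| ^ α ≠ 0 := (Real.rpow_pos_of_pos (abs_pos.2 h) α).ne'
    field_simp
    ring

theorem im_v0 {ξ : ℝ} (h : ξ ≠ 0) :
    (v0 α a₀ μ₀ ξ).im = -(charFun (μ₀ : Measure ℝ) ξ).im / |ξ| ^ α := by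
  rw [v0, if_neg h, Complex.sub_im, Complex.div_ofReal_im]
  simp

theorem exists_v0_bound (hv₀ : (v0 α a₀ μ₀) =O[𝓝[≠] 0] (fun ξ : ℝ => |ξ| ^ δ)) :
    ∃ C > 0, ∃ ε > 0, ∀ x : ℝ, |x| < ε → ‖v0 α a₀ μ₀ x‖ ≤ C * |x| ^ δ := by
  obtain ⟨C, hC, h⟩ := hv₀.exists_pos
  rw [Asymptotics.isBigOWith_iff, eventually_nhdsWithin_iff, Metric.eventually_nhds_iff] at h
  obtain ⟨ε, hε, h⟩ := h
  refine ⟨C, hC, ε, hε, fun x hx => ?_⟩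
  by_cases h0 : x = 0
  · rw [h0, v0, if_pos rfl, norm_zero]
    positivity
  · have := h (by simpa using hx) h0
    rwa [Real.norm_of_nonneg (by positivity)] at this

theorem norm_v0_le_of_le (hα : 0 < α) (ha₀ : 0 < a₀) {ε x : ℝ} (hε : 0 < ε) (hx : ε ≤ |x|) :
    ‖v0 α a₀ μ₀ x‖ ≤ 2 / ε ^ α + a₀ := by
  have hx0 : x ≠ 0 := abs_pos.1 (hε.trans_le hx)
  rw [v0, if_neg hx0]
  refine (norm_sub_le _ _).trans (add_le_add ?_ (by simp [abs_of_pos ha₀]))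
  rw [norm_div, Complex.norm_real, Real.norm_of_nonneg (by positivity)]
  refine div_le_div₀ (by norm_num) ?_ (by positivity) (Real.rpow_le_rpow hε.le hx hα.le)
  have h1 := norm_sub_le 1 (charFun (μ₀ : Measure ℝ) x)
  have h2 : ‖charFun (μ₀ : Measure ℝ) x‖ ≤ 1 := norm_charFun_le_one x
  rw [norm_one] at h1
  linarith

theorem exists_v0_le (hα : 0 < α) (ha₀ : 0 < a₀) (hδ : 0 < δ)
    (hv₀ : (v0 α a₀ μ₀) =O[𝓝[≠] 0] (fun ξ : ℝ => |ξ| ^ δ)) :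
    ∃ K, ∀ x, ‖v0 α a₀ μ₀ x‖ ≤ K := by
  obtain ⟨C, hC, ε, hε, h⟩ := exists_v0_bound hv₀
  refine ⟨max (C * ε ^ δ) (2 / ε ^ α + a₀), fun x => ?_⟩
  rcases lt_or_ge |x| ε with hx | hx
  · refine ((h x hx).trans ?_).trans (le_max_left _ _)
    exact mul_le_mul_of_nonneg_left (Real.rpow_le_rpow (abs_nonneg _) hx.le hδ.le) hC.le
  · exact (norm_v0_le_of_le hα ha₀ hε hx).trans (le_max_right _ _)

/-- A real `sSup` is a genuine upper bound only on a bounded set; this makes M and the running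
supremum usable. -/
theorem bddAbove_v0star (hα : 0 < α) (ha₀ : 0 < a₀) (hδ : 0 < δ)
    (hv₀ : (v0 α a₀ μ₀) =O[𝓝[≠] 0] (fun ξ : ℝ => |ξ| ^ δ)) (S : Set ℝ) :
    BddAbove ((fun ξ => |v0star α a₀ μ₀ ξ|) '' S) := by
  obtain ⟨K, hK⟩ := exists_v0_le hα ha₀ hδ hv₀
  refine ⟨K, ?_⟩
  rintro _ ⟨x, -, rfl⟩
  exact (abs_v0star_le x).trans (hK x)

theorem bddAbove_im_v0 (hα : 0 < α) (ha₀ : 0 < a₀)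
    (hv₀ : (v0 α a₀ μ₀) =O[𝓝[≠] 0] (fun ξ : ℝ => |ξ| ^ δ)) {r : ℝ} (hr : 0 < r) (hrδ : r ≤ δ) :
    BddAbove ((fun ξ : ℝ => |(v0 α a₀ μ₀ ξ).im| / |ξ| ^ r) '' {ξ | ξ ≠ 0}) := by
  obtain ⟨C, hC, ε, hε, h⟩ := exists_v0_bound hv₀
  refine ⟨max (C * ε ^ (δ - r)) ((2 / ε ^ α + a₀) / ε ^ r), ?_⟩
  rintro _ ⟨x, hx0, rfl⟩
  have hxpos : 0 < |x| := abs_pos.2 hx0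
  have hxr : 0 < |x| ^ r := Real.rpow_pos_of_pos hxpos r
  have him := Complex.abs_im_le_norm (v0 α a₀ μ₀ x)
  rcases lt_or_ge |x| ε with hx | hx
  · refine le_trans ?_ (le_max_left _ _)
    simp only
    rw [div_le_iff₀ hxr]
    refine (him.trans (h x hx)).trans ?_
    have : |x| ^ δ = |x| ^ (δ - r) * |x| ^ r := by
      rw [← Real.rpow_add hxpos, sub_add_cancel]
    rw [this, ← mul_assoc]
    refine mul_le_mul_of_nonneg_right (mul_le_mul_of_nonneg_left ?_ hC.le) hxr.le
    exact Real.rpow_le_rpow (abs_nonneg _) hx.le (sub_nonneg.2 hrδ)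
  · refine le_trans ?_ (le_max_right _ _)
    exact div_le_div₀ (by positivity) (him.trans (norm_v0_le_of_le hα ha₀ hε hx)) (by positivity)
      (Real.rpow_le_rpow hε.le hx hr.le)

theorem abs_v0star_le_constM_sub (hα : 0 < α) (ha₀ : 0 < a₀) (hδ : 0 < δ)
    (hv₀ : (v0 α a₀ μ₀) =O[𝓝[≠] 0] (fun ξ : ℝ => |ξ| ^ δ)) (x : ℝ) :
    |v0star α a₀ μ₀ x| ≤ constM α a₀ μ₀ - a₀ := by
  rw [constM, add_sub_cancel_left, ← v0star_abs]
  exact le_csSup (bddAbove_v0star hα ha₀ hδ hv₀ _) ⟨|x|, abs_nonneg x, rfl⟩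

theorem constM_pos (ha₀ : 0 < a₀) : 0 < constM α a₀ μ₀ := by
  refine add_pos_of_pos_of_nonneg ha₀ (Real.sSup_nonneg ?_)
  rintro _ ⟨x, -, rfl⟩
  exact abs_nonneg _

theorem abs_v0star_le_v0bar (hα : 0 < α) (ha₀ : 0 < a₀) (hδ : 0 < δ)
    (hv₀ : (v0 α a₀ μ₀) =O[𝓝[≠] 0] (fun ξ : ℝ => |ξ| ^ δ)) (x : ℝ) :
    |v0star α a₀ μ₀ x| ≤ v0bar α a₀ μ₀ |x| := by
  rw [← v0star_abs]
  exact le_csSup (bddAbove_v0star hα ha₀ hδ hv₀ _) ⟨|x|, ⟨abs_nonneg x, le_rfl⟩, rfl⟩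

theorem d1_mul_rpow (ha₀ : 0 < a₀) {d : ℝ} (hd : 0 < d) :
    d1 α a₀ μ₀ * d ^ (1 / α) = (3 * d / (8 * constM α a₀ μ₀)) ^ (1 / α) := by
  have hM := constM_pos (α := α) (μ₀ := μ₀) ha₀
  rw [d1, ← Real.mul_rpow (by positivity) hd.le]
  congr 1
  ring

theorem d1_pos (ha₀ : 0 < a₀) : 0 < d1 α a₀ μ₀ := by
  have hM := constM_pos (α := α) (μ₀ := μ₀) ha₀
  unfold d1
  positivity

theorem rpow_d1_mul (ha₀ : 0 < a₀) {d : ℝ} (hd : 0 < d) (r : ℝ) :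
    (d1 α a₀ μ₀ * d ^ (1 / α)) ^ r = d1 α a₀ μ₀ ^ r * d ^ (r / α) := by
  rw [Real.mul_rpow (d1_pos ha₀).le (by positivity), ← Real.rpow_mul hd.le]
  congr 2
  ring

/-- Comparison of a product of initial characteristic functions at small arguments with the
stable characteristic function. -/
theorem abs_prod_sub_exp_le (hα : 0 < α) (ha₀ : 0 < a₀) (hδ : 0 < δ)
    (hv₀ : (v0 α a₀ μ₀) =O[𝓝[≠] 0] (fun ξ : ℝ => |ξ| ^ δ)) {η d ρ : ℝ}
    (had : Admissible α a₀ δ μ₀ η d ρ) {w : ℝ} (b : Multiset ℝ)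
    (hw : (b.map fun x => |x| ^ α).sum = w)
    (hb : ∀ x ∈ b, |x| ≤ d1 α a₀ μ₀ * d ^ (1 / α)) :
    |(b.map fun x => (charFun (μ₀ : Measure ℝ) x).re).prod - Real.exp (-a₀ * w)|
      ≤ Real.exp (-(a₀ - η) * w) * (b.map fun x => ρ * |x| ^ (α + δ)
        + 4 / 5 * constM α a₀ μ₀ ^ 2 * |x| ^ (2 * α)).sum := by
  set M := constM α a₀ μ₀ with hM
  have hMpos : 0 < M := constM_pos ha₀
  let v := v0star α a₀ μ₀
  let z : ℝ → ℝ := fun x => (a₀ + v x) * |x| ^ α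
  -- For x in b, R x = log Re φ₀(x) + a₀|x|^α, the deviation from the stable exponent.
  let R : ℝ → ℝ := fun x => -(v x * |x| ^ α) + (z x + Real.log (1 - z x))
  have hz0 : ∀ x, 0 ≤ z x := fun x => by
    change 0 ≤ (a₀ + v0star α a₀ μ₀ x) * |x| ^ α
    rw [← one_sub_re_charFun hα]
    have := (Complex.abs_re_le_norm _).trans (norm_charFun_le_one (μ := (μ₀ : Measure ℝ)) x)
    linarith [(abs_le.1 this).2]
  have hzM : ∀ x, z x ≤ M * |x| ^ α := fun x => by
    refine mul_le_mul_of_nonneg_right ?_ (by positivity)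
    have := abs_v0star_le_constM_sub hα ha₀ hδ hv₀ x
    have := le_abs_self (v x)
    linarith
  have hzs : ∀ x ∈ b, z x ≤ 3 / 8 := fun x hx => by
    have h1 := Real.rpow_le_rpow (abs_nonneg x) (hb x hx) hα.le
    have h2 : (d1 α a₀ μ₀ * d ^ (1 / α)) ^ α = 3 * d / (8 * M) := by
      have := had.d_pos
      rw [d1_mul_rpow ha₀ had.d_pos, ← Real.rpow_mul (by positivity), one_div_mul_cancel hα.ne',
        Real.rpow_one]
    rw [h2] at h1
    have h3 : M * (3 * d / (8 * M)) = 3 / 8 * d := by field_simp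
    have h4 := mul_le_mul_of_nonneg_left h1 hMpos.le
    linarith [hzM x, had.d_lt]
  have hlog : ∀ x ∈ b, |z x + Real.log (1 - z x)| ≤ 4 / 5 * M ^ 2 * |x| ^ (2 * α) := fun x hx => by
    refine (abs_add_log_one_sub_le (hz0 x) (hzs x hx)).trans ?_
    have h1 := pow_le_pow_left₀ (hz0 x) (hzM x) 2
    have h2 : (M * |x| ^ α) ^ 2 = M ^ 2 * |x| ^ (2 * α) := by
      rw [mul_pow, ← Real.rpow_mul_natCast (abs_nonneg x), mul_comm α]
      norm_num
    rw [h2] at h1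
    linarith
  have hxx : ∀ x : ℝ, |x| ^ (2 * α) = |x| ^ α * |x| ^ α := fun x => by
    rw [← Real.rpow_add_of_nonneg (abs_nonneg x) hα.le hα.le, two_mul]
  -- R is bounded twice: here by the moments of the conclusion, and in `hR2` by η|x|^α. The latter
  -- sums to ηw and costs only the change from a₀ to a₀ - η in the exponential.
  have hR1 : ∀ x ∈ b, |R x| ≤ ρ * |x| ^ (α + δ) + 4 / 5 * M ^ 2 * |x| ^ (2 * α) := fun x hx => by
    refine (abs_add_le _ _).trans (add_le_add ?_ (hlog x hx))
    rw [abs_neg, abs_mul, abs_of_nonneg (by positivity : 0 ≤ |x| ^ α),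
      Real.rpow_add_of_nonneg (abs_nonneg x) hα.le hδ.le]
    have := mul_le_mul_of_nonneg_right ((abs_v0star_le x).trans (had.v0_le x (hb x hx)))
      (by positivity : 0 ≤ |x| ^ α)
    refine this.trans (le_of_eq (by ring))
  have hR2 : ∀ x ∈ b, |R x| ≤ η * |x| ^ α := fun x hx => by
    refine (abs_add_le _ _).trans ((add_le_add le_rfl (hlog x hx)).trans ?_)
    rw [abs_neg, abs_mul, abs_of_nonneg (by positivity : 0 ≤ |x| ^ α), hxx]
    have h1 := had.small x (by rw [← d1_mul_rpow ha₀ had.d_pos]; exact hb x hx)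
    have h2 := abs_v0star_le_v0bar hα ha₀ hδ hv₀ x
    have h3 : |v x| + 4 / 5 * M ^ 2 * |x| ^ α ≤ η := by
      change |v0star α a₀ μ₀ x| + _ ≤ _
      linarith
    have := mul_le_mul_of_nonneg_right h3 (by positivity : 0 ≤ |x| ^ α)
    linarith
  set Δ := (b.map R).sum with hΔ
  have hsumabs : |Δ| ≤ (b.map fun x => |R x|).sum := by
    have := Multiset.abs_sum_le_sum_abs (s := b.map R)
    rwa [Multiset.map_map] at this
  have hΔ1 := hsumabs.trans (Multiset.sum_map_le_sum_map _ _ hR1)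
  have hΔ2 : |Δ| ≤ η * w := by
    refine (hsumabs.trans (Multiset.sum_map_le_sum_map _ _ hR2)).trans (le_of_eq ?_)
    rw [Multiset.sum_map_mul_left, hw]
  have hprod : (b.map fun x => (charFun (μ₀ : Measure ℝ) x).re).prod = Real.exp (-a₀ * w + Δ) := by
    rw [← hw, hΔ, ← Multiset.sum_map_mul_left, ← Multiset.sum_map_add, Real.exp_multiset_sum,
      Multiset.map_map]
    congr 1
    refine Multiset.map_congr rfl fun x hx => ?_
    have h1 : (charFun (μ₀ : Measure ℝ) x).re = 1 - z x := by
      change _ = 1 - (a₀ + v0star α a₀ μ₀ x) * |x| ^ α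
      rw [← one_sub_re_charFun hα]
      ring
    have h2 : -a₀ * |x| ^ α + R x = Real.log (1 - z x) := by
      simp only [R, z]
      ring
    have h3 := hzs x hx
    simp only [Function.comp]
    rw [h1, h2, Real.exp_log (by linarith)]
  have hsplit : Real.exp (-a₀ * w + Δ) - Real.exp (-a₀ * w)
      = Real.exp (-a₀ * w) * (Real.exp Δ - 1) := by
    rw [Real.exp_add]
    ring
  rw [hprod, hsplit, abs_mul, abs_of_pos (Real.exp_pos _)]
  have hexp : Real.exp (-(a₀ - η) * w) = Real.exp (-a₀ * w) * Real.exp (η * w) := by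
    rw [← Real.exp_add]
    ring_nf
  rw [hexp, mul_assoc]
  refine mul_le_mul_of_nonneg_left ((abs_exp_sub_one_le_mul_exp Δ).trans ?_) (Real.exp_pos _).le
  rw [mul_comm]
  exact mul_le_mul (Real.exp_le_exp.2 hΔ2) hΔ1 (abs_nonneg _) (Real.exp_pos _).le

/-- A family with an element outside the range of small arguments has a large moment. -/
theorem abs_prod_sub_exp_le_of_exists (ha₀ : 0 < a₀) {d : ℝ} (hd : 0 < d) {r : ℝ} (hr : 0 < r)
    {g : ℝ} (hg : |g| ≤ 1) (b : Multiset ℝ) (hb : ∃ x ∈ b, d1 α a₀ μ₀ * d ^ (1 / α) < |x|) :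
    |(b.map fun x => (charFun (μ₀ : Measure ℝ) x).re).prod - g|
      ≤ 2 / (d1 α a₀ μ₀ ^ r * d ^ (r / α)) * (b.map fun x => |x| ^ r).sum := by
  obtain ⟨x, hx, hlt⟩ := hb
  have h1 := abs_multiset_prod_map_le_one b (f := fun x => (charFun (μ₀ : Measure ℝ) x).re)
    fun x => (Complex.abs_re_le_norm _).trans (norm_charFun_le_one x)
  have h2 := abs_sub (b.map fun x => (charFun (μ₀ : Measure ℝ) x).re).prod g
  have hd1 := d1_pos (α := α) (μ₀ := μ₀) ha₀
  have h3 : |x| ^ r ≤ (b.map fun x => |x| ^ r).sum := by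
    refine Multiset.single_le_sum ?_ _ (Multiset.mem_map_of_mem _ hx)
    intro y hy
    obtain ⟨x, -, rfl⟩ := Multiset.mem_map.1 hy
    positivity
  -- With κ = d₁ d^{1/α}, the single large element already gives 1 ≤ (|x|/κ)^r, which pays for the
  -- trivial bound 2.
  have h4 := Real.rpow_le_rpow (by positivity) hlt.le hr.le
  rw [rpow_d1_mul ha₀ hd] at h4
  have hκ : 0 < d1 α a₀ μ₀ ^ r * d ^ (r / α) := by positivity
  rw [div_mul_eq_mul_div, le_div_iff₀ hκ]
  have h5 : |(b.map fun x => (charFun (μ₀ : Measure ℝ) x).re).prod - g| ≤ 2 := by linarith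
  exact mul_le_mul h5 (h4.trans h3) hκ.le (by norm_num)

/-- Take ρ to be the constant C near 0. The threshold κ tends to 0 with d, so a small d brings
(4/5)M²κ^α + Cκ^δ below η. -/
theorem exists_admissible (hα : 0 < α) (ha₀ : 0 < a₀) (hδ : 0 < δ)
    (hv₀ : (v0 α a₀ μ₀) =O[𝓝[≠] 0] (fun ξ : ℝ => |ξ| ^ δ)) {η : ℝ} (hη : 0 < η) (hηa : η < a₀) :
    ∃ d ρ : ℝ, Admissible α a₀ δ μ₀ η d ρ := by
  obtain ⟨C, hC, ε, hε, h⟩ := exists_v0_bound hv₀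
  have hM := constM_pos (α := α) (μ₀ := μ₀) ha₀
  set M := constM α a₀ μ₀ with hMdef
  have hlim : Tendsto (fun d : ℝ => (3 * d / (8 * M)) ^ (1 / α)) (𝓝 0) (𝓝 0) := by
    have : Continuous fun d : ℝ => (3 * d / (8 * M)) ^ (1 / α) :=
      ((continuous_const.mul continuous_id).div_const _).rpow_const
        fun _ => Or.inr (by positivity)
    have h0 := this.tendsto 0
    simpa [Real.zero_rpow (inv_ne_zero hα.ne')] using h0
  have hlim2 : Tendsto (fun y : ℝ => 4 / 5 * M ^ 2 * |y| ^ α + C * |y| ^ δ) (𝓝 0) (𝓝 0) := by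
    have : Continuous fun y : ℝ => 4 / 5 * M ^ 2 * |y| ^ α + C * |y| ^ δ :=
      ((continuous_abs.rpow_const fun _ => Or.inr hα.le).const_mul _).add
        ((continuous_abs.rpow_const fun _ => Or.inr hδ.le).const_mul _)
    have h0 := this.tendsto 0
    simpa [Real.zero_rpow hα.ne', Real.zero_rpow hδ.ne'] using h0
  have hev : ∀ᶠ d in 𝓝[>] (0 : ℝ), (3 * d / (8 * M)) ^ (1 / α) < ε ∧
      4 / 5 * M ^ 2 * |(3 * d / (8 * M)) ^ (1 / α)| ^ α
        + C * |(3 * d / (8 * M)) ^ (1 / α)| ^ δ < η ∧ d < 1 ∧ 0 < d := by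
    refine Eventually.and (mem_nhdsWithin_of_mem_nhds (hlim.eventually_lt_const hε))
      (Eventually.and (mem_nhdsWithin_of_mem_nhds ((hlim2.comp hlim).eventually_lt_const hη))
        (Eventually.and (mem_nhdsWithin_of_mem_nhds (eventually_lt_nhds one_pos))
          self_mem_nhdsWithin))
  obtain ⟨d, hdε, hdη, hd1, hd0⟩ := hev.exists
  set κ := (3 * d / (8 * M)) ^ (1 / α) with hκ
  have hκ0 : 0 ≤ κ := by positivity
  rw [abs_of_nonneg hκ0] at hdη
  refine ⟨d, C, hη, hηa, hd0, hd1, fun x hx => ?_, hC, fun x hx => ?_⟩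
  · have hbar : v0bar α a₀ μ₀ |x| ≤ C * κ ^ δ := by
      refine csSup_le ⟨_, 0, ⟨le_rfl, abs_nonneg x⟩, rfl⟩ ?_
      rintro _ ⟨y, hy, rfl⟩
      have hyκ : |y| ≤ κ := by
        rw [abs_of_nonneg hy.1]
        exact hy.2.trans hx
      refine ((abs_v0star_le y).trans (h y (hyκ.trans_lt hdε))).trans ?_
      exact mul_le_mul_of_nonneg_left (Real.rpow_le_rpow (abs_nonneg _) hyκ hδ.le) hC.le
    have h1 : 4 / 5 * M ^ 2 * |x| ^ α ≤ 4 / 5 * M ^ 2 * κ ^ α :=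
      mul_le_mul_of_nonneg_left (Real.rpow_le_rpow (abs_nonneg _) hx hα.le) (by positivity)
    linarith
  · rw [d1_mul_rpow ha₀ hd0] at hx
    exact h x (hx.trans_lt hdε)

end Initial

end InelasticKac

namespace InelasticKac

/-! ### Convergence to equilibrium -/

section Convergence

variable {p α a₀ δ η : ℝ} {μ₀ G : ProbabilityMeasure ℝ} {μ : ℝ → ProbabilityMeasure ℝ}

theorem constMr_nonneg (r : ℝ) : 0 ≤ constMr α a₀ η r := by
  refine Real.sSup_nonneg ?_
  rintro _ ⟨x, hx, rfl⟩
  exact mul_nonneg (Real.rpow_nonneg hx _) (Real.exp_pos _).le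

theorem supIm_nonneg (r : ℝ) : 0 ≤ supIm α a₀ r μ₀ := by
  refine Real.sSup_nonneg ?_
  rintro _ ⟨x, -, rfl⟩
  positivity

/-- Only the finiteness of the supremum M_r is at stake, so a crude bound suffices. -/
theorem rpow_mul_exp_neg_le {c r y : ℝ} (hc : 0 < c) (hr : 0 ≤ r) (hy : 0 ≤ y) :
    y ^ r * Real.exp (-c * y) ≤ 1 + (⌈r⌉₊).factorial / c ^ ⌈r⌉₊ := by
  set n := ⌈r⌉₊
  have h1 : y ^ r ≤ 1 + y ^ n := by
    rcases le_total y 1 with h | h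
    · have := Real.rpow_le_one hy h hr
      have : 0 ≤ y ^ n := by positivity
      linarith
    · have := Real.rpow_le_rpow_of_exponent_le h (Nat.le_ceil r)
      rw [Real.rpow_natCast] at this
      linarith
  have h2 := Real.pow_div_factorial_le_exp (c * y) (by positivity) n
  have h3 : y ^ n ≤ n.factorial / c ^ n * Real.exp (c * y) := by
    have hf : (0 : ℝ) < n.factorial := by exact_mod_cast n.factorial_pos
    rw [mul_pow, div_le_iff₀ hf] at h2
    rw [div_mul_eq_mul_div, le_div_iff₀ (by positivity)]
    linarith
  have h4 : Real.exp (c * y) * Real.exp (-c * y) = 1 := by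
    rw [← Real.exp_add]
    simp
  have h5 : Real.exp (-c * y) ≤ 1 := by
    rw [Real.exp_le_one_iff, neg_mul]
    exact neg_nonpos.2 (by positivity)
  have h6 := Real.exp_pos (-c * y)
  calc y ^ r * Real.exp (-c * y)
      ≤ (1 + n.factorial / c ^ n * Real.exp (c * y)) * Real.exp (-c * y) :=
        mul_le_mul_of_nonneg_right (by linarith) h6.le
    _ = Real.exp (-c * y) + n.factorial / c ^ n * (Real.exp (c * y) * Real.exp (-c * y)) := by ring
    _ ≤ _ := by rw [h4, mul_one]; linarith

theorem rpow_mul_exp_le_constMr (hα : 0 < α) (hη : η < a₀) {s x : ℝ} (hs : 0 ≤ s) (hx : 0 ≤ x) :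
    x ^ s * Real.exp (-(a₀ - η) * x ^ α) ≤ constMr α a₀ η (s / α) := by
  have hsα : s / α * α = s := div_mul_cancel₀ _ hα.ne'
  refine le_csSup ⟨1 + (⌈s / α⌉₊).factorial / (a₀ - η) ^ ⌈s / α⌉₊, ?_⟩
    ⟨x, hx, by simp only [hsα]⟩
  rintro _ ⟨y, hy, rfl⟩
  have hy0 : (0 : ℝ) ≤ y := hy
  have := rpow_mul_exp_neg_le (sub_pos.2 hη) (div_nonneg hs hα.le) (Real.rpow_nonneg hy0 α)
  rwa [← Real.rpow_mul hy0, mul_comm α] at this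

/-- Since ξ is fixed, c₁, c₂ and g may depend on it; this lets the factor exp(-(a₀ - η)|ξ|^α) enter
the coefficients. -/
theorem abs_re_charFun_sub_le (hp : 0 < p) (hα : α = 2 / (1 + p)) (hδ : 0 < δ)
    (hμ : IsKacSolution p μ₀ μ) {c₁ c₂ g : ℝ} (hc₁ : 0 ≤ c₁) (hc₂ : 0 ≤ c₂) (hg : |g| ≤ 1) (ξ : ℝ)
    (h0 : ∀ b : Multiset ℝ, (b.map fun x => |x| ^ α).sum = |ξ| ^ α →
      |(b.map fun x => (charFun (μ₀ : Measure ℝ) x).re).prod - g|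
        ≤ (b.map fun x => c₁ * |x| ^ (α + δ) + c₂ * |x| ^ (2 * α)).sum) {t : ℝ} (ht : 0 ≤ t) :
    |(charFun (μ t : Measure ℝ) ξ).re - g|
      ≤ c₁ * Real.exp (-t * (1 - 2 * constA (2 * (1 + δ / α)))) * |ξ| ^ (α + δ)
        + c₂ * Real.exp (-t * (1 - 2 * constA 4)) * |ξ| ^ (2 * α) := by
  have hα0 : 0 < α := by
    rw [hα]
    positivity
  have e1 : (1 + p) * (α + δ) = 2 * (1 + δ / α) := by
    rw [hα]
    field_simp
  have e2 : (1 + p) * (2 * α) = 4 := by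
    rw [hα]
    field_simp
    norm_num
  have hh := (isLinearKacSolution_rpow hp hc₁ (by positivity : 0 ≤ α + δ)).add hp
    (isLinearKacSolution_rpow hp hc₂ (by positivity : 0 ≤ 2 * α))
  rw [e1, e2] at hh
  refine abs_sub_le_of_initial_bound hp hα (hμ.isRealKacSolution hp) hh hg ξ (fun b hb => ?_) ht
  simpa only [hμ.initial, neg_zero, zero_mul, Real.exp_zero, mul_one] using h0 b hb

/-- The stable characteristic function is real, so the imaginary part of the error is e^{-t} Im φ₀,
of modulus e^{-t}|Im v₀||ξ|^α. -/
theorem chi_le (hp : 0 < p) (hα : 0 < α) (ha₀ : 0 < a₀) (hG : IsStableLaw α a₀ G)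
    (hμ : IsKacSolution p μ₀ μ) (hv₀ : (v0 α a₀ μ₀) =O[𝓝[≠] 0] (fun ξ : ℝ => |ξ| ^ δ))
    {r : ℝ} (hr : 0 < r) (hrδ : r ≤ δ) {t : ℝ} (ht : 0 ≤ t) {K : ℝ}
    (hK : ∀ ξ : ℝ, ξ ≠ 0 → |(charFun (μ t : Measure ℝ) ξ).re - Real.exp (-a₀ * |ξ| ^ α)|
      ≤ K * |ξ| ^ (α + r)) :
    chi (α + r) (μ t) G ≤ ENNReal.ofReal (K + Real.exp (-t) * supIm α a₀ r μ₀) := by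
  refine iSup₂_le fun ξ hξ => ENNReal.ofReal_le_ofReal ?_
  have hξ0 : 0 < |ξ| := abs_pos.2 hξ
  have hpow : 0 < |ξ| ^ (α + r) := Real.rpow_pos_of_pos hξ0 _
  rw [div_le_iff₀ hpow, hG ξ]
  refine (Complex.norm_le_abs_re_add_abs_im _).trans ?_
  rw [Complex.sub_re, Complex.sub_im, Complex.ofReal_re, Complex.ofReal_im, sub_zero, add_mul]
  refine add_le_add (hK ξ hξ) ?_
  rw [hμ.im_charFun hp ξ ht, abs_mul, abs_of_pos (Real.exp_pos _), mul_assoc]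
  refine mul_le_mul_of_nonneg_left ?_ (Real.exp_pos _).le
  have h1 : |(v0 α a₀ μ₀ ξ).im| / |ξ| ^ r ≤ supIm α a₀ r μ₀ :=
    le_csSup (bddAbove_im_v0 hα ha₀ hv₀ hr hrδ) ⟨ξ, hξ, rfl⟩
  have hα' : 0 < |ξ| ^ α := Real.rpow_pos_of_pos hξ0 _
  have hr' : 0 < |ξ| ^ r := Real.rpow_pos_of_pos hξ0 _
  rw [im_v0 hξ, abs_div, abs_neg, abs_of_pos hα', div_div, div_le_iff₀ (by positivity),
    ← Real.rpow_add hξ0] at h1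
  exact h1

/-- Explicit bound on the distance to equilibrium for `δ ≤ α`. -/
theorem chi_add_le (hp : 0 < p) (hα : α = 2 / (1 + p)) (ha₀ : 0 < a₀) (hG : IsStableLaw α a₀ G)
    (hμ : IsKacSolution p μ₀ μ) (hδ : 0 < δ)
    (hv₀ : (v0 α a₀ μ₀) =O[𝓝[≠] 0] (fun ξ : ℝ => |ξ| ^ δ)) {d ρ : ℝ}
    (had : Admissible α a₀ δ μ₀ η d ρ) (hδα : δ ≤ α) {t : ℝ} (ht : 0 ≤ t) :
    chi (α + δ) (μ t) G ≤ ENNReal.ofReal (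
      (ρ + 2 / (d1 α a₀ μ₀ ^ (α + δ) * d ^ ((α + δ) / α)))
          * Real.exp (-t * (1 - 2 * constA (2 * (1 + δ / α))))
        + 4 / 5 * constM α a₀ μ₀ ^ 2 * constMr α a₀ η ((α - δ) / α)
          * Real.exp (-t * (1 - 2 * constA 4))
        + Real.exp (-t) * supIm α a₀ δ μ₀) := by
  have hα0 : 0 < α := by
    rw [hα]
    positivity
  refine chi_le hp hα0 ha₀ hG hμ hv₀ hδ le_rfl ht fun ξ hξ => ?_
  have hξ0 : 0 < |ξ| := abs_pos.2 hξ
  have hρ := had.rho_pos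
  have hd := had.d_pos
  have hd1 := d1_pos (α := α) (μ₀ := μ₀) ha₀
  set M := constM α a₀ μ₀ with hM
  set w := |ξ| ^ α with hw
  have hw0 : 0 ≤ w := by positivity
  set L := 2 / (d1 α a₀ μ₀ ^ (α + δ) * d ^ ((α + δ) / α)) with hL
  have hL0 : 0 ≤ L := by positivity
  set e := Real.exp (-(a₀ - η) * w) with he
  have he0 : 0 < e := Real.exp_pos _
  have he1 : e ≤ 1 := by
    rw [he, Real.exp_le_one_iff, neg_mul]
    exact neg_nonpos.2 (mul_nonneg (sub_nonneg.2 had.eta_lt.le) hw0)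
  have hg : |Real.exp (-a₀ * w)| ≤ 1 := by
    rw [abs_of_pos (Real.exp_pos _), Real.exp_le_one_iff, neg_mul]
    exact neg_nonpos.2 (by positivity)
  -- The factor e is kept only on |x|^{2α}, the power in excess of α + δ; elsewhere e ≤ 1. The
  -- large-element cost L goes with |x|^{α+δ}.
  have key := abs_re_charFun_sub_le hp hα hδ hμ (c₁ := ρ + L) (c₂ := 4 / 5 * M ^ 2 * e)
    (by positivity) (by positivity) hg ξ (fun b hb => ?_) ht
  · refine key.trans ?_
    rw [add_mul _ _ (|ξ| ^ (α + δ))]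
    refine add_le_add le_rfl ?_
    -- The excess |ξ|^{α-δ} has a nonnegative exponent because δ ≤ α, and e absorbs it.
    have h1 := rpow_mul_exp_le_constMr hα0 had.eta_lt (sub_nonneg.2 hδα) hξ0.le
    have h2 : |ξ| ^ (2 * α) = |ξ| ^ (α - δ) * |ξ| ^ (α + δ) := by
      rw [← Real.rpow_add hξ0]
      congr 1
      ring
    have h3 : 0 ≤ 4 / 5 * M ^ 2 * Real.exp (-t * (1 - 2 * constA 4)) * |ξ| ^ (α + δ) := by
      positivity
    have h4 := mul_le_mul_of_nonneg_left h1 h3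
    rw [h2]
    calc _ = 4 / 5 * M ^ 2 * Real.exp (-t * (1 - 2 * constA 4)) * |ξ| ^ (α + δ)
          * (|ξ| ^ (α - δ) * e) := by ring
      _ ≤ _ := h4
      _ = _ := by ring
  · by_cases hsmall : ∀ x ∈ b, |x| ≤ d1 α a₀ μ₀ * d ^ (1 / α)
    · refine (abs_prod_sub_exp_le hα0 ha₀ hδ hv₀ had b hb hsmall).trans ?_
      rw [← Multiset.sum_map_mul_left]
      refine Multiset.sum_map_le_sum_map _ _ fun x _ => ?_
      have hx : 0 ≤ |x| ^ (α + δ) := by positivity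
      have h1 : e * (ρ * |x| ^ (α + δ)) ≤ 1 * (ρ * |x| ^ (α + δ)) :=
        mul_le_mul_of_nonneg_right he1 (by positivity)
      have h2 : 0 ≤ L * |x| ^ (α + δ) := by positivity
      change e * _ ≤ _
      linarith
    · push Not at hsmall
      refine (abs_prod_sub_exp_le_of_exists ha₀ hd (by positivity : 0 < α + δ) hg b hsmall).trans ?_
      rw [← Multiset.sum_map_mul_left]
      refine Multiset.sum_map_le_sum_map _ _ fun x _ => ?_
      have h1 : 0 ≤ ρ * |x| ^ (α + δ) := by positivity
      have h2 : 0 ≤ 4 / 5 * M ^ 2 * e * |x| ^ (2 * α) := by positivity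
      change L * _ ≤ _
      linarith

/-- Explicit bound on the distance to equilibrium for `δ > α`. -/
theorem chi_two_mul_le (hp : 0 < p) (hα : α = 2 / (1 + p)) (ha₀ : 0 < a₀) (hG : IsStableLaw α a₀ G)
    (hμ : IsKacSolution p μ₀ μ) (hδ : 0 < δ)
    (hv₀ : (v0 α a₀ μ₀) =O[𝓝[≠] 0] (fun ξ : ℝ => |ξ| ^ δ)) {d ρ : ℝ}
    (had : Admissible α a₀ δ μ₀ η d ρ) (hαδ : α < δ) {t : ℝ} (ht : 0 ≤ t) :
    chi (2 * α) (μ t) G ≤ ENNReal.ofReal (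
      (4 / 5 * constM α a₀ μ₀ ^ 2 + 2 / (d1 α a₀ μ₀ ^ (2 * α) * d ^ 2))
          * Real.exp (-t * (1 - 2 * constA 4))
        + ρ * constMr α a₀ η ((δ - α) / α)
          * Real.exp (-t * (1 - 2 * constA (2 * (1 + δ / α))))
        + Real.exp (-t) * supIm α a₀ α μ₀) := by
  have hα0 : 0 < α := by
    rw [hα]
    positivity
  have hd2 : d ^ 2 = d ^ (2 * α / α) := by
    rw [mul_div_cancel_right₀ _ hα0.ne']
    exact (Real.rpow_two d).symm
  rw [hd2, two_mul α]
  refine chi_le hp hα0 ha₀ hG hμ hv₀ hα0 hαδ.le ht fun ξ hξ => ?_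
  rw [← two_mul α]
  have hξ0 : 0 < |ξ| := abs_pos.2 hξ
  have hρ := had.rho_pos
  have hd := had.d_pos
  have hd1 := d1_pos (α := α) (μ₀ := μ₀) ha₀
  set M := constM α a₀ μ₀ with hM
  set w := |ξ| ^ α with hw
  have hw0 : 0 ≤ w := by positivity
  set L := 2 / (d1 α a₀ μ₀ ^ (2 * α) * d ^ (2 * α / α)) with hL
  have hL0 : 0 ≤ L := by positivity
  set e := Real.exp (-(a₀ - η) * w) with he
  have he0 : 0 < e := Real.exp_pos _
  have he1 : e ≤ 1 := by
    rw [he, Real.exp_le_one_iff, neg_mul]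
    exact neg_nonpos.2 (mul_nonneg (sub_nonneg.2 had.eta_lt.le) hw0)
  have hg : |Real.exp (-a₀ * w)| ≤ 1 := by
    rw [abs_of_pos (Real.exp_pos _), Real.exp_le_one_iff, neg_mul]
    exact neg_nonpos.2 (by positivity)
  -- For δ > α the roles are exchanged: |x|^{α+δ} is now the excess power and carries e.
  have key := abs_re_charFun_sub_le hp hα hδ hμ (c₁ := ρ * e) (c₂ := 4 / 5 * M ^ 2 + L)
    (by positivity) (by positivity) hg ξ (fun b hb => ?_) ht
  · refine key.trans ?_
    rw [add_mul _ _ (|ξ| ^ (2 * α)), add_comm]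
    refine add_le_add le_rfl ?_
    have h1 := rpow_mul_exp_le_constMr hα0 had.eta_lt (sub_nonneg.2 hαδ.le) hξ0.le
    have h2 : |ξ| ^ (α + δ) = |ξ| ^ (δ - α) * |ξ| ^ (2 * α) := by
      rw [← Real.rpow_add hξ0]
      congr 1
      ring
    have h3 : 0 ≤ ρ * Real.exp (-t * (1 - 2 * constA (2 * (1 + δ / α)))) * |ξ| ^ (2 * α) := by
      positivity
    have h4 := mul_le_mul_of_nonneg_left h1 h3
    rw [h2]
    calc _ = ρ * Real.exp (-t * (1 - 2 * constA (2 * (1 + δ / α)))) * |ξ| ^ (2 * α)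
          * (|ξ| ^ (δ - α) * e) := by ring
      _ ≤ _ := h4
      _ = _ := by ring
  · by_cases hsmall : ∀ x ∈ b, |x| ≤ d1 α a₀ μ₀ * d ^ (1 / α)
    · refine (abs_prod_sub_exp_le hα0 ha₀ hδ hv₀ had b hb hsmall).trans ?_
      rw [← Multiset.sum_map_mul_left]
      refine Multiset.sum_map_le_sum_map _ _ fun x _ => ?_
      have hx : 0 ≤ |x| ^ (2 * α) := by positivity
      have h1 : e * (4 / 5 * M ^ 2 * |x| ^ (2 * α)) ≤ 1 * (4 / 5 * M ^ 2 * |x| ^ (2 * α)) :=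
        mul_le_mul_of_nonneg_right he1 (by positivity)
      have h2 : 0 ≤ L * |x| ^ (2 * α) := by positivity
      change e * _ ≤ _
      linarith
    · push Not at hsmall
      refine (abs_prod_sub_exp_le_of_exists ha₀ hd (by positivity : 0 < 2 * α) hg b hsmall).trans ?_
      rw [← Multiset.sum_map_mul_left]
      refine Multiset.sum_map_le_sum_map _ _ fun x _ => ?_
      have h1 : 0 ≤ 4 / 5 * M ^ 2 * |x| ^ (2 * α) := by positivity
      have h2 : 0 ≤ ρ * e * |x| ^ (α + δ) := by positivity
      change L * _ ≤ _
      linarith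

theorem exp_neg_mul_le_exp_neg_mul {t m m' : ℝ} (ht : 0 ≤ t) (hm : 0 < m) (h : m ≤ m') :
    Real.exp (-t * (1 - 2 * constA m')) ≤ Real.exp (-t * (1 - 2 * constA m)) := by
  rw [Real.exp_le_exp]
  have := mul_le_mul_of_nonneg_left (constA_anti hm h) ht
  linarith

theorem exp_neg_le_exp_neg_mul {t : ℝ} (ht : 0 ≤ t) (m : ℝ) :
    Real.exp (-t) ≤ Real.exp (-t * (1 - 2 * constA m)) := by
  rw [Real.exp_le_exp]
  have := mul_nonneg ht (constA_nonneg m)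
  linarith

end Convergence

end InelasticKac

/-! ### The explicit and condensed bounds -/

open InelasticKac in
theorem theorem3
    (p : ℝ) (hp : 0 < p) (α : ℝ) (hα : α = 2 / (1 + p))
    (a₀ : ℝ) (ha₀ : 0 < a₀)
    (G : ProbabilityMeasure ℝ) (hG : IsStableLaw α a₀ G)
    (μ₀ : ProbabilityMeasure ℝ) (hμ₀ : InNormalDomain α G μ₀)
    (μ : ℝ → ProbabilityMeasure ℝ) (hμ : IsKacSolution p μ₀ μ)
    (δ : ℝ) (hδ : 0 < δ)
    (hv₀ : (v0 α a₀ μ₀) =O[𝓝[≠] 0] (fun ξ : ℝ => |ξ| ^ δ)) :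
    -- the bounds with explicit constants, for every admissible choice of `η`, `d`, `ρ`
    (∀ η d ρ : ℝ, Admissible α a₀ δ μ₀ η d ρ →
      (δ ≤ α → ∀ t : ℝ, 0 ≤ t →
        chi (α + δ) (μ t) G ≤ ENNReal.ofReal (
          (ρ + 2 / (d1 α a₀ μ₀ ^ (α + δ) * d ^ ((α + δ) / α)))
              * Real.exp (-t * (1 - 2 * constA (2 * (1 + δ / α))))
          + 4 / 5 * constM α a₀ μ₀ ^ 2 * constMr α a₀ η ((α - δ) / α)
              * Real.exp (-t * (1 - 2 * constA 4))
          + 2 * ρ ^ 2 * constMr α a₀ η ((α + δ) / α)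
              * Real.exp (-t * (1 - 2 * constA (2 * (1 + 2 * δ / α))))
          + 32 / 25 * constM α a₀ μ₀ ^ 4 * constMr α a₀ η ((3 * α - δ) / α)
              * Real.exp (-t * (1 - 2 * constA 6))
          + Real.exp (-t) * supIm α a₀ δ μ₀)) ∧
      (α < δ → δ ≤ 2 * α → ∀ t : ℝ, 0 ≤ t →
        chi (2 * α) (μ t) G ≤ ENNReal.ofReal (
          (4 / 5 * constM α a₀ μ₀ ^ 2 + 2 / (d1 α a₀ μ₀ ^ (2 * α) * d ^ 2))
              * Real.exp (-t * (1 - 2 * constA 4))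
          + ρ * constMr α a₀ η ((δ - α) / α)
              * Real.exp (-t * (1 - 2 * constA (2 * (1 + δ / α))))
          + 32 / 25 * constM α a₀ μ₀ ^ 4 * constMr α a₀ η 2
              * Real.exp (-t * (1 - 2 * constA 6))
          + 2 * ρ ^ 2 * constMr α a₀ η (2 * δ / α)
              * Real.exp (-t * (1 - 2 * constA (2 * (1 + 2 * δ / α))))
          + Real.exp (-t) * supIm α a₀ α μ₀))) ∧
    -- admissible choices exist, for every `η ∈ (0, a₀)`
    (∀ η : ℝ, 0 < η → η < a₀ → ∃ d ρ : ℝ, Admissible α a₀ δ μ₀ η d ρ) ∧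
    -- the condensed form
    (δ ≤ α → ∃ a₁ : ℝ, ∀ t : ℝ, 0 ≤ t →
      chi (α + δ) (μ t) G
        ≤ ENNReal.ofReal (a₁ * Real.exp (-t * (1 - 2 * constA (2 * (1 + δ / α)))))) ∧
    (α < δ → δ ≤ 2 * α → ∃ a₂ : ℝ, ∀ t : ℝ, 0 ≤ t →
      chi (2 * α) (μ t) G
        ≤ ENNReal.ofReal (a₂ * Real.exp (-t * (1 - 2 * constA 4)))) := by
  have hα0 : 0 < α := by
    rw [hα]
    positivity
  have hexists : ∀ η : ℝ, 0 < η → η < a₀ → ∃ d ρ : ℝ, Admissible α a₀ δ μ₀ η d ρ :=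
    fun η hη hηa => exists_admissible hα0 ha₀ hδ hv₀ hη hηa
  refine ⟨fun η d ρ had => ⟨fun hδα t ht => ?_, fun hαδ _ t ht => ?_⟩, hexists,
    fun hδα => ?_, fun hαδ _ => ?_⟩
  · refine (chi_add_le hp hα ha₀ hG hμ hδ hv₀ had hδα ht).trans (ENNReal.ofReal_le_ofReal ?_)
    -- `chi_add_le` is stronger: the ρ² and M⁴ terms are nonnegative and are simply added.
    have h1 : 0 ≤ 2 * ρ ^ 2 * constMr α a₀ η ((α + δ) / α)
        * Real.exp (-t * (1 - 2 * constA (2 * (1 + 2 * δ / α)))) :=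
      mul_nonneg (mul_nonneg (by positivity) (constMr_nonneg _)) (Real.exp_pos _).le
    have h2 : 0 ≤ 32 / 25 * constM α a₀ μ₀ ^ 4 * constMr α a₀ η ((3 * α - δ) / α)
        * Real.exp (-t * (1 - 2 * constA 6)) :=
      mul_nonneg (mul_nonneg (by positivity) (constMr_nonneg _)) (Real.exp_pos _).le
    linarith
  · refine (chi_two_mul_le hp hα ha₀ hG hμ hδ hv₀ had hαδ ht).trans (ENNReal.ofReal_le_ofReal ?_)
    have h1 : 0 ≤ 2 * ρ ^ 2 * constMr α a₀ η (2 * δ / α)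
        * Real.exp (-t * (1 - 2 * constA (2 * (1 + 2 * δ / α)))) :=
      mul_nonneg (mul_nonneg (by positivity) (constMr_nonneg _)) (Real.exp_pos _).le
    have h2 : 0 ≤ 32 / 25 * constM α a₀ μ₀ ^ 4 * constMr α a₀ η 2
        * Real.exp (-t * (1 - 2 * constA 6)) :=
      mul_nonneg (mul_nonneg (by positivity) (constMr_nonneg _)) (Real.exp_pos _).le
    linarith
  · obtain ⟨d, ρ, had⟩ := hexists (a₀ / 2) (by linarith) (by linarith)
    refine ⟨ρ + 2 / (d1 α a₀ μ₀ ^ (α + δ) * d ^ ((α + δ) / α))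
      + 4 / 5 * constM α a₀ μ₀ ^ 2 * constMr α a₀ (a₀ / 2) ((α - δ) / α)
      + supIm α a₀ δ μ₀, fun t ht => ?_⟩
    refine (chi_add_le hp hα ha₀ hG hμ hδ hv₀ had hδα ht).trans (ENNReal.ofReal_le_ofReal ?_)
    -- A_m is nonincreasing in m and nonnegative, so the smallest index gives the slowest
    -- exponential, which dominates the others and e^{-t}.
    have hm : 2 * (1 + δ / α) ≤ 4 := by
      have := (div_le_one hα0).2 hδα
      linarith
    have h1 := mul_le_mul_of_nonneg_left
      (exp_neg_mul_le_exp_neg_mul ht (by positivity : 0 < 2 * (1 + δ / α)) hm)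
      (mul_nonneg (by positivity : 0 ≤ 4 / 5 * constM α a₀ μ₀ ^ 2)
        (constMr_nonneg (α := α) (a₀ := a₀) (η := a₀ / 2) ((α - δ) / α)))
    have h2 := mul_le_mul_of_nonneg_right (exp_neg_le_exp_neg_mul ht (2 * (1 + δ / α)))
      (supIm_nonneg (α := α) (a₀ := a₀) (μ₀ := μ₀) δ)
    linarith
  · obtain ⟨d, ρ, had⟩ := hexists (a₀ / 2) (by linarith) (by linarith)
    refine ⟨4 / 5 * constM α a₀ μ₀ ^ 2 + 2 / (d1 α a₀ μ₀ ^ (2 * α) * d ^ 2)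
      + ρ * constMr α a₀ (a₀ / 2) ((δ - α) / α) + supIm α a₀ α μ₀, fun t ht => ?_⟩
    refine (chi_two_mul_le hp hα ha₀ hG hμ hδ hv₀ had hαδ ht).trans (ENNReal.ofReal_le_ofReal ?_)
    have hm : 4 ≤ 2 * (1 + δ / α) := by
      have := (one_le_div hα0).2 hαδ.le
      linarith
    have h1 := mul_le_mul_of_nonneg_left
      (exp_neg_mul_le_exp_neg_mul ht (by norm_num : (0 : ℝ) < 4) hm)
      (mul_nonneg had.rho_pos.le
        (constMr_nonneg (α := α) (a₀ := a₀) (η := a₀ / 2) ((δ - α) / α)))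
    have h2 := mul_le_mul_of_nonneg_right (exp_neg_le_exp_neg_mul ht 4)
      (supIm_nonneg (α := α) (a₀ := a₀) (μ₀ := μ₀) α)
    linarith
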